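/- **Setting.** Let $\Omega\subset\mathbb R^2$ be a polygonal domain: bounded, open, connected, with boundary a finite union of segments (slits and cracks are allowed). Let $\mathbf A$ be a vertex or crack tip of $\Omega$ with interior angle $\omega\in(0,2\pi]$, and let $(r,\theta)$ be polar coordinates at $\mathbf A$, with $\theta=0$ on one of the two edges at $\mathbf A$, $\theta=\omega$ on the other, and $\theta$ continuous in $\Omega$. For some integer $j\ge 1$ put $\alpha=j\pi/\omega$ and $$S_{\mathbf A}(r,\theta)=\begin{cases} r^{\alpha}\sin(\alpha\theta) & \text{if }\alpha\notin\mathbb N,\\ r^{\alpha}\bigl(\log r\,\sin(\alpha\theta)+\theta\cos(\alpha\theta)\bigr)&\text{if }\alpha\in\mathbb N.\end{cases}$$ Let $p\ge1$ be an integer; if $\alpha\in\mathbb N$, assume $\alpha\le p$. Let $f\in L^2(\Omega)$ be analytic in $\Omega$ and let $u\in H^1_0(\Omega)$ be the weak solution of $-\Delta u=f$, i.e. $\int_\Omega\nabla u\cdot\nabla v=\int_\Omega fv$ for all $v\in H^1_0(\Omega)$. Assume that $u=u_0+\kappa S_{\mathbf A}$ a.e. in $\Omega$, where $\kappa\in\mathbb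 R$ and $u_0$ is analytic on (a neighbourhood of) $\overline\Omega$. **Mesh.** Let $\mathcal T_n$ be a finite partition of $\Omega$ into nonoverlapping simple polygons. A polygon may contain part of a crack of $\Omega$ in its interior; the element $K$ is then the open polygon minus the crack, and $K$ is assumed connected (no element is completely cut by a crack). Let $h_K$ be the diameter of $K$, $h=\max_K h_K$, and $\mathbf x_K$ the barycenter of $K$. Assume that for some $\gamma\in(0,1)$: * (A0) $\gamma h_{K_1}\le h_{K_2}\le\gamma^{-1}h_{K_1}$ for all $K_1,K_2\in\mathcal T_n$; * (A1) every polygon of $\mathcal T_n$ is star-shaped with respect to a ball of radius at least $\gamma h_K$; * (A2) every edge of every polygon has length at least $\gamma h_K$. Given $\widetilde\gamma>0$, let $\mathcal T_n^1=\{K\in\mathcal T_n: |\mathbf A-\mathbf x_K|\le\widetilde\gamma\,\mathrm{diam}(\Omega)\}$, let $\mathcal T_n^2$ be the set of elements not in $\mathcal T_n^1$ sharing at least one edge with an element of $\mathcal T_n^1$, and let $\mathcal T_n^3=\mathcal T_n\setminus(\mathcal T_n^1\cup\mathcal T_n^2)$. Assume that a polygon containing $\mathbf A$ in its interior (where $\mathbf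 A$ is then a crack tip) belongs to $\mathcal T_n^1$. Let $\mathbb P_p(K)$ be the polynomials of total degree at most $p$, and let $$\widetilde{\mathbb P}_p(K)=\mathbb P_p(K)+\mathrm{span}\{S_{\mathbf A}(r/h_K,\theta)\}\ \text{ if }K\in\mathcal T_n^1,\qquad \widetilde{\mathbb P}_p(K)=\mathbb P_p(K)\ \text{ otherwise.}$$ Write $|v|_{s,K}^2=\sum_{|m|=s}\|\partial^m v\|_{L^2(K)}^2$ with weak derivatives, set to $+\infty$ when some weak derivative of order $s$ is missing or is not in $L^2(K)$, and write $|v|_{1,\mathcal T_n}^2=\sum_{K\in\mathcal T_n}|v|_{1,K}^2$. **Claim.** There is a constant $c>0$ depending only on $p$ and $\gamma$ such that, in every such situation, there is a function $u_\pi$ with $u_\pi|_K\in\widetilde{\mathbb P}_p(K)$ for all $K\in\mathcal T_n$, such that $$|u-u_\pi|_{1,\mathcal T_n}\le c\,h^p\Bigl\{\Bigl(\sum_{K\in\mathcal T_n^1}|u_0|_{p+1,K}^2\Bigr)^{1/2}+\Bigl(\sum_{K\in\mathcal T_n^2\cup\mathcal T_n^3}|u|_{p+1,K}^2\Bigr)^{1/2}\Bigr\}$$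 and such that, on each $K\in\mathcal T_n^1$, the singular part is reproduced exactly: $u_\pi|_K-\kappa S_{\mathbf A}|_K\in\mathbb P_p(K)$. -/

import Mathlib

open MeasureTheory Filter Topology
open scoped ENNReal

noncomputable section

namespace EnrichedVEM

/-- The Euclidean plane. -/
abbrev Plane : Type := EuclideanSpace ℝ (Fin 2)

/-! ### Weak derivatives and Sobolev seminorms -/

/-- The classical partial derivative in the `i`-th coordinate direction. -/
def pderiv (i : Fin 2) (φ : Plane → ℝ) : Plane → ℝ :=
  fun x => fderiv ℝ φ x (EuclideanSpace.single i 1)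

/-- The classical derivative of multi-index `m = (m₁, m₂)`. -/
def mderiv (m : ℕ × ℕ) (φ : Plane → ℝ) : Plane → ℝ :=
  (pderiv 0)^[m.1] ((pderiv 1)^[m.2] φ)

/-- Test functions, i.e. elements of `C_c^∞(D)`. -/
structure IsTest (D : Set Plane) (φ : Plane → ℝ) : Prop where
  smooth : ContDiff ℝ (⊤ : ℕ∞) φ
  compactSupport : HasCompactSupport φ
  support_subset : tsupport φ ⊆ D

/-- `g` is the weak derivative of multi-index `m` of `v` on the open set `D`. -/
structure IsWeakDeriv (D : Set Plane) (m : ℕ × ℕ) (v g : Plane → ℝ) : Prop where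
  locallyIntegrable : LocallyIntegrableOn v D
  locallyIntegrable_deriv : LocallyIntegrableOn g D
  integral_eq : ∀ φ : Plane → ℝ, IsTest D φ →
    ∫ x in D, v x * mderiv m φ x = (-1) ^ (m.1 + m.2) * ∫ x in D, g x * φ x

/-- The square of the Sobolev seminorm, `|v|²_{s,D} = ∑_{|m| = s} ‖∂^m v‖²_{0,D}`. Weak derivatives
are unique up to null sets, so the infimum only selects the derivative when it exists; it equals
`∞` when some weak derivative of order `s` does not exist or is not square integrable. -/
def sobolevSq (s : ℕ) (D : Set Plane) (v : Plane → ℝ) : ℝ≥0∞ :=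
  ∑ m ∈ Finset.HasAntidiagonal.antidiagonal s,
    ⨅ (g : Plane → ℝ) (_ : IsWeakDeriv D m v g), ∫⁻ x in D, ‖g x‖ₑ ^ 2

/-- `v ∈ H¹₀(D)` with weak gradient `g`: both are square integrable, and `(v, g)` is the `L²` limit
of `(φₙ, ∇φₙ)` for a sequence of test functions `φₙ`. -/
structure MemH10 (D : Set Plane) (v : Plane → ℝ) (g : Fin 2 → Plane → ℝ) : Prop where
  memLp : MemLp v 2 (volume.restrict D)
  memLp_grad : ∀ i, MemLp (g i) 2 (volume.restrict D)
  weak_x : IsWeakDeriv D (1, 0) v (g 0)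
  weak_y : IsWeakDeriv D (0, 1) v (g 1)
  approx : ∃ φ : ℕ → Plane → ℝ, (∀ n, IsTest D (φ n)) ∧
    Tendsto (fun n => eLpNorm (v - φ n) 2 (volume.restrict D)) atTop (𝓝 0) ∧
    ∀ i, Tendsto (fun n => eLpNorm (g i - pderiv i (φ n)) 2 (volume.restrict D)) atTop (𝓝 0)

/-- `u ∈ H¹₀(Ω)` is the weak solution of `-Δu = f` in `Ω`, `u = 0` on the boundary. -/
def IsWeakSolution (Ω : Set Plane) (f u : Plane → ℝ) : Prop :=
  ∃ g : Fin 2 → Plane → ℝ, MemH10 Ω u g ∧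
    ∀ (v : Plane → ℝ) (w : Fin 2 → Plane → ℝ), MemH10 Ω v w →
      ∫ x in Ω, ∑ i, g i x * w i x = ∫ x in Ω, f x * v x

/-! ### Polygonal domains, vertices and singular functions -/

/-- Polygonal domains: bounded, open, connected, with boundary a finite union of nondegenerate
segments. Slits and internal cracks are allowed, since `Ω` may lie on both sides of a segment. -/
structure IsPolygonalDomain (Ω : Set Plane) : Prop where
  isOpen : IsOpen Ω
  isConnected : IsConnected Ω
  isBounded : Bornology.IsBounded Ω
  frontier_eq : ∃ s : Finset (Plane × Plane), (∀ e ∈ s, e.1 ≠ e.2) ∧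
    frontier Ω = ⋃ e ∈ s, segment ℝ e.1 e.2

/-- The unit vector of angle `t`. -/
def dir (t : ℝ) : Plane := !₂[Real.cos t, Real.sin t]

/-- `A` is a vertex (or a crack tip) of `Ω` with interior angle `ω`, and `(dist x A, θ x)` are polar
coordinates centred at `A`. The two edges at `A` have directions `β` and `β + ω`; `θ` vanishes on
the first of them, increases counterclockwise, and is continuous in `Ω`. Near `A`, only the sector
between the two edges is required to lie in `Ω`, because two vertices may have the same
coordinates when a slit starts from the boundary. -/
structure IsVertex (Ω : Set Plane) (A : Plane) (β ω : ℝ) (θ : Plane → ℝ) : Prop where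
  angle_pos : 0 < ω
  angle_le : ω ≤ 2 * Real.pi
  sector : ∃ ρ : ℝ, 0 < ρ ∧
    (∀ r t : ℝ, 0 < r → r < ρ → 0 < t → t < ω →
      A + r • dir (β + t) ∈ Ω ∧ θ (A + r • dir (β + t)) = t) ∧
    (∀ r : ℝ, 0 ≤ r → r < ρ →
      A + r • dir β ∈ frontier Ω ∧ A + r • dir (β + ω) ∈ frontier Ω)
  polar : ∀ x ∈ Ω, x = A + dist x A • dir (β + θ x)
  continuousOn : ContinuousOn θ Ω

open Classical in
/-- The singular function of exponent `α` at a Dirichlet vertex, in polar coordinates. -/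
def singular (α r t : ℝ) : ℝ :=
  if ∃ m : ℕ, α = m then
    r ^ α * (Real.log r * Real.sin (α * t) + t * Real.cos (α * t))
  else
    r ^ α * Real.sin (α * t)

/-- The singular function centred at `A`, with the radius rescaled by the length `h`,
`x ↦ S(r / h, θ)`; for `h = 1` this is the singular function itself. -/
def singularAt (A : Plane) (θ : Plane → ℝ) (α h : ℝ) : Plane → ℝ :=
  fun x => singular α (dist x A / h) (θ x)

/-! ### Polygonal meshes -/

/-- A simple polygon: `vert` lists its vertices cyclically (angles equal to `π` are allowed), and
`region` is the open set enclosed by its closed boundary curve. -/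
structure Polygon where
  n : ℕ
  three_le : 3 ≤ n
  vert : ZMod n → Plane
  vert_injective : Function.Injective vert
  adjacent : ∀ i, segment ℝ (vert i) (vert (i + 1)) ∩ segment ℝ (vert (i + 1)) (vert (i + 2))
    = {vert (i + 1)}
  nonadjacent : ∀ i j, j ≠ i → j ≠ i + 1 → i ≠ j + 1 →
    Disjoint (segment ℝ (vert i) (vert (i + 1))) (segment ℝ (vert j) (vert (j + 1)))
  region : Set Plane
  isOpen : IsOpen region
  isConnected : IsConnected region
  isBounded : Bornology.IsBounded region
  frontier_eq : frontier region = ⋃ i, segment ℝ (vert i) (vert (i + 1))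

/-- The edge joining the vertices `i` and `i + 1`. -/
def Polygon.edge (P : Polygon) (i : ZMod P.n) : Set Plane :=
  segment ℝ (P.vert i) (P.vert (i + 1))

/-- The diameter `h_K`. -/
def Polygon.size (P : Polygon) : ℝ := Metric.diam P.region

/-- The barycenter `x_K`. -/
def Polygon.barycenter (P : Polygon) : Plane := ⨍ x in P.region, x

/-- A finite family of nonoverlapping polygons partitioning `Ω`. A polygon may contain part of a
crack of `Ω` in its interior; the element is then `region ∩ Ω`, and its connectedness
says that no element is completely cracked. -/
structure IsMesh (Ω : Set Plane) {N : ℕ} (T : Fin N → Polygon) : Prop where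
  disjoint : ∀ k l, k ≠ l → Disjoint (T k).region (T l).region
  cover : ⋃ k, closure (T k).region = closure Ω
  connected : ∀ k, IsConnected ((T k).region ∩ Ω)

/-- The element `K` as an open subset of `Ω`: the polygon minus the cracks of `Ω`. -/
def element (Ω : Set Plane) {N : ℕ} (T : Fin N → Polygon) (k : Fin N) : Set Plane :=
  (T k).region ∩ Ω

/-- The mesh size `h`, i.e. the largest diameter. -/
def meshSize {N : ℕ} (T : Fin N → Polygon) : ℝ := ⨆ k, (T k).size

/-- The mesh regularity assumptions with parameter `γ`. -/
structure IsRegularMesh (γ : ℝ) {N : ℕ} (T : Fin N → Polygon) : Prop where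
  quasiUniform : ∀ k l, γ * (T k).size ≤ (T l).size ∧ (T l).size ≤ γ⁻¹ * (T k).size
  starShaped : ∀ k, ∃ (z : Plane) (ρ : ℝ), γ * (T k).size ≤ ρ ∧
    ∀ y ∈ Metric.ball z ρ, StarConvex ℝ y (T k).region
  edges : ∀ k i, γ * (T k).size ≤ dist ((T k).vert i) ((T k).vert (i + 1))

open Classical in
/-- First layer: the elements whose barycenter has distance at most `γ' diam Ω` from `A`. -/
def layer1 (Ω : Set Plane) (A : Plane) (γ' : ℝ) {N : ℕ} (T : Fin N → Polygon) : Finset (Fin N) :=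
  Finset.univ.filter fun k => dist A (T k).barycenter ≤ γ' * Metric.diam Ω

open Classical in
/-- Second layer: the other elements that share an edge with an element of the first layer. Edges
on the boundary of `Ω` belong to one element only (across a slit, edges are not shared). -/
def layer2 (Ω : Set Plane) (A : Plane) (γ' : ℝ) {N : ℕ} (T : Fin N → Polygon) : Finset (Fin N) :=
  Finset.univ.filter fun k => k ∉ layer1 Ω A γ' T ∧
    ∃ l ∈ layer1 Ω A γ' T, ∃ i j, (T k).edge i = (T l).edge j ∧ ¬ (T k).edge i ⊆ frontier Ω

open Classical in
/-- Third layer: the remaining elements. -/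
def layer3 (Ω : Set Plane) (A : Plane) (γ' : ℝ) {N : ℕ} (T : Fin N → Polygon) : Finset (Fin N) :=
  Finset.univ.filter fun k => k ∉ layer1 Ω A γ' T ∧ k ∉ layer2 Ω A γ' T

/-! ### Enriched polynomials -/

/-- Polynomials of total degree at most `p`, as functions on the plane. -/
def polySpace (p : ℕ) : Submodule ℝ (Plane → ℝ) :=
  Submodule.map
    (LinearMap.pi fun x : Plane => (MvPolynomial.aeval (fun i => x i)).toLinearMap)
    (MvPolynomial.restrictTotalDegree (Fin 2) ℝ p)

open Classical in
/-- The enriched polynomials on the element `k`: polynomials of degree at most `p` plus, in the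
first layer, the multiples of the singular function scaled by `h_K`. -/
def enrichedSpace (p : ℕ) (Ω : Set Plane) (A : Plane) (θ : Plane → ℝ) (α γ' : ℝ)
    {N : ℕ} (T : Fin N → Polygon) (k : Fin N) : Submodule ℝ (Plane → ℝ) :=
  if k ∈ layer1 Ω A γ' T then
    polySpace p ⊔ Submodule.span ℝ {singularAt A θ α (T k).size}
  else polySpace p

end EnrichedVEM

end

/-! The estimate is local: on each polygon a function smooth on the whole open polygon is
approximated by a polynomial, and the squared errors are summed.

On a first-layer element take `uπ = κ S + q` with `q` approximating `u₀`. The singular parts cancel,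
so the error is `u₀ - q`, and `u₀` is smooth across cracks because it is analytic on `closure Ω`.
The multiple `κ S` lies in the enriched space although that space contains `S` with a rescaled
radius: rescaling produces a factor and, for integer `α ≤ p`, a multiple of `r ^ α sin (α θ)`, the
imaginary part of a power of a complex coordinate and hence a polynomial of degree at most `p`
(`singularAt_one_eq`).

On any other element `A` is outside the polygon. The polygon is star-shaped about some `z`, so it
misses the ray from `A` pointing away from `z`, and a smooth branch of the logarithm exists on it.
As `S` is the imaginary part of an entire function of `log r + i θ`, it extends smoothly from the
connected cracked element to the whole polygon (`exists_contDiffOn_eqOn_singularAt`). So `u` too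
agrees a.e. with a smooth function there.

Cracks are null sets, so the seminorms of such functions on the cracked element equal classical
integrals over the full star-shaped polygon. There the Bramble–Hilbert bound
(`exists_polySpace_classicalSq_le`) comes from a polynomial matching the means, over a ball, of all
derivatives of order at most `p`, and from `p` applications of an explicit Poincaré inequality
(`poincare`). Infinite seminorms on the right are harmless in `ℝ≥0∞`. -/

namespace EnrichedVEM

/-! ### Classical partial derivatives of smooth functions on open sets -/

section Calculus

variable {D : Set Plane} {F G : Plane → ℝ}

theorem pderiv_congr (hD : IsOpen D) (h : Set.EqOn F G D) (i : Fin 2) :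
    Set.EqOn (pderiv i F) (pderiv i G) D := by
  intro x hx
  have : F =ᶠ[𝓝 x] G := h.eventuallyEq_of_mem (hD.mem_nhds hx)
  simp only [pderiv, this.fderiv_eq]

theorem iterate_pderiv_congr (hD : IsOpen D) (h : Set.EqOn F G D) (i : Fin 2) (n : ℕ) :
    Set.EqOn ((pderiv i)^[n] F) ((pderiv i)^[n] G) D := by
  induction n generalizing F G with
  | zero => exact h
  | succ n ih => exact ih (pderiv_congr hD h i)

theorem mderiv_congr (hD : IsOpen D) (h : Set.EqOn F G D) (m : ℕ × ℕ) :
    Set.EqOn (mderiv m F) (mderiv m G) D :=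
  iterate_pderiv_congr hD (iterate_pderiv_congr hD h 1 m.2) 0 m.1

theorem contDiffOn_pderiv (hD : IsOpen D) (hF : ContDiffOn ℝ (⊤ : ℕ∞) F D) (i : Fin 2) :
    ContDiffOn ℝ (⊤ : ℕ∞) (pderiv i F) D :=
  (hF.fderiv_of_isOpen hD (m := (⊤ : ℕ∞)) (by simp)).clm_apply contDiffOn_const

theorem contDiffOn_iterate_pderiv (hD : IsOpen D) (hF : ContDiffOn ℝ (⊤ : ℕ∞) F D) (i : Fin 2)
    (n : ℕ) : ContDiffOn ℝ (⊤ : ℕ∞) ((pderiv i)^[n] F) D := by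
  induction n generalizing F with
  | zero => exact hF
  | succ n ih => exact ih (contDiffOn_pderiv hD hF i)

theorem contDiffOn_mderiv (hD : IsOpen D) (hF : ContDiffOn ℝ (⊤ : ℕ∞) F D) (m : ℕ × ℕ) :
    ContDiffOn ℝ (⊤ : ℕ∞) (mderiv m F) D :=
  contDiffOn_iterate_pderiv hD (contDiffOn_iterate_pderiv hD hF 1 m.2) 0 m.1

theorem _root_.ContDiffOn.differentiableAt_of_isOpen (hF : ContDiffOn ℝ (⊤ : ℕ∞) F D)
    (hD : IsOpen D) {x : Plane} (hx : x ∈ D) : DifferentiableAt ℝ F x :=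
  (hF.contDiffAt (hD.mem_nhds hx)).differentiableAt (by simp)

theorem pderiv_sub (hD : IsOpen D) (hF : ContDiffOn ℝ (⊤ : ℕ∞) F D)
    (hG : ContDiffOn ℝ (⊤ : ℕ∞) G D) (i : Fin 2) :
    Set.EqOn (pderiv i (F - G)) (pderiv i F - pderiv i G) D := by
  intro x hx
  simp only [pderiv, Pi.sub_apply]
  rw [fderiv_sub (hF.differentiableAt_of_isOpen hD hx) (hG.differentiableAt_of_isOpen hD hx)]
  rfl

theorem iterate_pderiv_sub (hD : IsOpen D) (hF : ContDiffOn ℝ (⊤ : ℕ∞) F D)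
    (hG : ContDiffOn ℝ (⊤ : ℕ∞) G D) (i : Fin 2) (n : ℕ) :
    Set.EqOn ((pderiv i)^[n] (F - G)) ((pderiv i)^[n] F - (pderiv i)^[n] G) D := by
  induction n generalizing F G with
  | zero => exact fun _ _ => rfl
  | succ n ih =>
    exact (iterate_pderiv_congr hD (pderiv_sub hD hF hG i) i n).trans
      (ih (contDiffOn_pderiv hD hF i) (contDiffOn_pderiv hD hG i))

theorem mderiv_sub (hD : IsOpen D) (hF : ContDiffOn ℝ (⊤ : ℕ∞) F D)
    (hG : ContDiffOn ℝ (⊤ : ℕ∞) G D) (m : ℕ × ℕ) :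
    Set.EqOn (mderiv m (F - G)) (mderiv m F - mderiv m G) D :=
  (iterate_pderiv_congr hD (iterate_pderiv_sub hD hF hG 1 m.2) 0 m.1).trans
    (iterate_pderiv_sub hD (contDiffOn_iterate_pderiv hD hF 1 m.2)
      (contDiffOn_iterate_pderiv hD hG 1 m.2) 0 m.1)

theorem pderiv_comm (hD : IsOpen D) (hF : ContDiffOn ℝ (⊤ : ℕ∞) F D) (i j : Fin 2) :
    Set.EqOn (pderiv i (pderiv j F)) (pderiv j (pderiv i F)) D := by
  intro x hx
  have hx' := hF.contDiffAt (hD.mem_nhds hx)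
  have hd : DifferentiableAt ℝ (fderiv ℝ F) x :=
    ((hF.fderiv_of_isOpen hD (m := (⊤ : ℕ∞)) (by simp)).contDiffAt
      (hD.mem_nhds hx)).differentiableAt (by simp)
  have hs : IsSymmSndFDerivAt ℝ F x :=
    hx'.isSymmSndFDerivAt (by
      rw [minSmoothness_of_isRCLikeNormedField]; exact WithTop.coe_le_coe.2 (le_top (a := (2 : ℕ∞))))
  have key : ∀ (k : Fin 2) (w : Plane), fderiv ℝ (pderiv k F) x w
      = fderiv ℝ (fderiv ℝ F) x w (EuclideanSpace.single k 1) := by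
    intro k w
    unfold pderiv
    rw [fderiv_clm_apply hd (differentiableAt_const _)]
    simp
  change fderiv ℝ (pderiv j F) x _ = fderiv ℝ (pderiv i F) x _
  rw [key, key]
  exact hs.eq _ _

theorem pderiv_iterate_comm (hD : IsOpen D) (hF : ContDiffOn ℝ (⊤ : ℕ∞) F D) (i j : Fin 2)
    (n : ℕ) : Set.EqOn (pderiv i ((pderiv j)^[n] F)) ((pderiv j)^[n] (pderiv i F)) D := by
  induction n generalizing F with
  | zero => exact fun _ _ => rfl
  | succ n ih =>
    exact (ih (contDiffOn_pderiv hD hF j)).trans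
      (iterate_pderiv_congr hD (pderiv_comm hD hF i j) j n)

theorem pderiv_zero_mderiv (m : ℕ × ℕ) (F : Plane → ℝ) :
    pderiv 0 (mderiv m F) = mderiv (m.1 + 1, m.2) F := by
  simp only [mderiv, Function.iterate_succ', Function.comp]

theorem pderiv_one_mderiv (hD : IsOpen D) (hF : ContDiffOn ℝ (⊤ : ℕ∞) F D) (m : ℕ × ℕ) :
    Set.EqOn (pderiv 1 (mderiv m F)) (mderiv (m.1, m.2 + 1) F) D := by
  simp only [mderiv, Function.iterate_succ', Function.comp]
  exact pderiv_iterate_comm hD (contDiffOn_iterate_pderiv hD hF 1 m.2) 1 0 m.1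

/-- Integration by parts moves derivatives onto `F` in the reverse of the order fixed by `mderiv`;
this restores it. -/
theorem iterate_pderiv_one_iterate_zero (hD : IsOpen D) (hF : ContDiffOn ℝ (⊤ : ℕ∞) F D)
    (a b : ℕ) : Set.EqOn ((pderiv 1)^[b] ((pderiv 0)^[a] F)) (mderiv (a, b) F) D := by
  induction b with
  | zero => exact fun _ _ => rfl
  | succ b ih =>
    rw [Function.iterate_succ']
    exact (pderiv_congr hD ih 1).trans (pderiv_one_mderiv hD hF (a, b))

end Calculus

/-! ### Weak derivatives of smooth functions -/

section Weak

variable {D : Set Plane} {F : Plane → ℝ}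

theorem IsTest.pderiv {φ : Plane → ℝ} (h : IsTest D φ) (i : Fin 2) : IsTest D (pderiv i φ) where
  smooth := (contDiffOn_univ.1 (contDiffOn_pderiv isOpen_univ (contDiffOn_univ.2 h.smooth) i))
  compactSupport := h.compactSupport.fderiv_apply ℝ _
  support_subset := (tsupport_fderiv_apply_subset ℝ _).trans h.support_subset

theorem IsTest.iterate_pderiv {φ : Plane → ℝ} (h : IsTest D φ) (i : Fin 2) (n : ℕ) :
    IsTest D ((EnrichedVEM.pderiv i)^[n] φ) := by
  induction n generalizing φ with
  | zero => exact h
  | succ n ih => exact ih (h.pderiv i)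

theorem integrable_mul_isTest (hF : ContinuousOn F D) {φ : Plane → ℝ} (h : IsTest D φ) :
    Integrable fun x => F x * φ x := by
  have hc : IntegrableOn (fun x => F x * φ x) (tsupport φ) :=
    ((hF.mono h.support_subset).mul h.smooth.continuous.continuousOn).integrableOn_compact
      h.compactSupport
  rwa [integrableOn_iff_integrable_of_support_subset] at hc
  intro x hx
  exact subset_tsupport _ (right_ne_zero_of_mul hx)

theorem setIntegral_mul_isTest (g : Plane → ℝ) {φ : Plane → ℝ} (h : IsTest D φ) :
    ∫ x in D, g x * φ x = ∫ x, g x * φ x := by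
  apply setIntegral_eq_integral_of_forall_compl_eq_zero
  intro x hx
  rw [image_eq_zero_of_notMem_tsupport fun h' => hx (h.support_subset h'), mul_zero]

/-- The support of `φ` is compact in `D`, so there is no boundary term and the behaviour of `F` near
or beyond the boundary is irrelevant. -/
theorem integral_mul_pderiv (hD : IsOpen D) (hF : ContDiffOn ℝ (⊤ : ℕ∞) F D) {φ : Plane → ℝ}
    (h : IsTest D φ) (i : Fin 2) :
    ∫ x in D, F x * pderiv i φ x = -∫ x in D, pderiv i F x * φ x := by
  rw [setIntegral_mul_isTest F (h.pderiv i), setIntegral_mul_isTest _ h]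
  exact integral_mul_fderiv_eq_neg_fderiv_mul_of_integrable
    (integrable_mul_isTest (contDiffOn_pderiv hD hF i).continuousOn h)
    (integrable_mul_isTest hF.continuousOn (h.pderiv i))
    (integrable_mul_isTest hF.continuousOn h)
    (fun x hx => hF.differentiableAt_of_isOpen hD (h.support_subset hx))
    (fun x _ => h.smooth.differentiable (by simp) x)

theorem integral_mul_iterate_pderiv (hD : IsOpen D) (hF : ContDiffOn ℝ (⊤ : ℕ∞) F D)
    {φ : Plane → ℝ} (h : IsTest D φ) (i : Fin 2) (n : ℕ) :
    ∫ x in D, F x * (pderiv i)^[n] φ x = (-1) ^ n * ∫ x in D, (pderiv i)^[n] F x * φ x := by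
  induction n generalizing F with
  | zero => simp
  | succ n ih =>
    rw [Function.iterate_succ', Function.comp, integral_mul_pderiv hD hF (h.iterate_pderiv i n),
      ih (contDiffOn_pderiv hD hF i)]
    rw [← Function.iterate_succ', Function.iterate_succ_apply, pow_succ]
    ring

theorem integral_mul_mderiv (hD : IsOpen D) (hF : ContDiffOn ℝ (⊤ : ℕ∞) F D) {φ : Plane → ℝ}
    (h : IsTest D φ) (m : ℕ × ℕ) :
    ∫ x in D, F x * mderiv m φ x = (-1) ^ (m.1 + m.2) * ∫ x in D, mderiv m F x * φ x := by
  rw [mderiv, integral_mul_iterate_pderiv hD hF (h.iterate_pderiv 1 m.2),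
    integral_mul_iterate_pderiv hD (contDiffOn_iterate_pderiv hD hF 0 m.1) h, ← mul_assoc,
    ← pow_add]
  congr 1
  exact setIntegral_congr_fun hD.measurableSet fun x hx => by
    simp only [iterate_pderiv_one_iterate_zero hD hF m.1 m.2 hx]

theorem isWeakDeriv_mderiv (hD : IsOpen D) (hF : ContDiffOn ℝ (⊤ : ℕ∞) F D) {v : Plane → ℝ}
    (hv : v =ᵐ[volume.restrict D] F) (m : ℕ × ℕ) : IsWeakDeriv D m v (mderiv m F) where
  locallyIntegrable := by
    have := hF.continuousOn.locallyIntegrableOn hD.measurableSet (μ := volume)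
    intro x hx
    obtain ⟨U, hU, hU'⟩ := this x hx
    refine ⟨U ∩ D, inter_mem hU self_mem_nhdsWithin, ?_⟩
    refine (hU'.mono_set Set.inter_subset_left).congr_fun_ae ?_
    exact ae_mono (Measure.restrict_mono Set.inter_subset_right le_rfl) hv.symm
  locallyIntegrable_deriv :=
    (contDiffOn_mderiv hD hF m).continuousOn.locallyIntegrableOn hD.measurableSet
  integral_eq φ hφ := by
    rw [← integral_mul_mderiv hD hF hφ m]
    refine integral_congr_ae ?_
    filter_upwards [hv] with x hx
    rw [hx]

/-- The fundamental lemma of the calculus of variations, applied to `g₁ - g₂`. -/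
theorem IsWeakDeriv.ae_eq (hD : IsOpen D) {m : ℕ × ℕ} {v g₁ g₂ : Plane → ℝ}
    (h₁ : IsWeakDeriv D m v g₁) (h₂ : IsWeakDeriv D m v g₂) :
    g₁ =ᵐ[volume.restrict D] g₂ := by
  have key := hD.ae_eq_zero_of_integral_contDiff_smul_eq_zero (μ := volume) (f := g₁ - g₂)
    (h₁.locallyIntegrable_deriv.sub h₂.locallyIntegrable_deriv) ?_
  · rw [Filter.EventuallyEq, ae_restrict_iff' hD.measurableSet]
    filter_upwards [key] with x hx hxD
    exact sub_eq_zero.1 (hx hxD)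
  · intro φ hφ hc hs
    have ht : IsTest D φ := ⟨hφ, hc, hs⟩
    have hi : ∀ g : Plane → ℝ, LocallyIntegrableOn g D → Integrable fun x => g x * φ x := by
      intro g hg
      have : IntegrableOn g (tsupport φ) := hg.integrableOn_compact_subset hs hc
      have h3 := this.mul_continuousOn hφ.continuous.continuousOn hc
      rwa [integrableOn_iff_integrable_of_support_subset] at h3
      intro x hx
      exact subset_tsupport _ (right_ne_zero_of_mul hx)
    have e := (h₁.integral_eq φ ht).symm.trans (h₂.integral_eq φ ht)
    rw [setIntegral_mul_isTest _ ht, setIntegral_mul_isTest _ ht] at e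
    have e' := mul_left_cancel₀ (pow_ne_zero _ (by norm_num)) e
    calc ∫ x, φ x • (g₁ - g₂) x = ∫ x, (g₁ x * φ x - g₂ x * φ x) := by
          congr 1; ext x; simp; ring
      _ = 0 := by
          rw [integral_sub (hi _ h₁.locallyIntegrable_deriv) (hi _ h₂.locallyIntegrable_deriv), e',
            sub_self]

/-- The Sobolev seminorm computed with classical derivatives. -/
noncomputable def classicalSq (s : ℕ) (D : Set Plane) (F : Plane → ℝ) : ℝ≥0∞ :=
  ∑ m ∈ Finset.HasAntidiagonal.antidiagonal s, ∫⁻ x in D, ‖mderiv m F x‖ₑ ^ 2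

/-- By uniqueness, all competitors in the infimum have the same integral as the classical
derivative. Both sides may be infinite. -/
theorem sobolevSq_eq_classicalSq (hD : IsOpen D) (hF : ContDiffOn ℝ (⊤ : ℕ∞) F D)
    {v : Plane → ℝ} (hv : v =ᵐ[volume.restrict D] F) (s : ℕ) :
    sobolevSq s D v = classicalSq s D F := by
  refine Finset.sum_congr rfl fun m _ => le_antisymm ?_ ?_
  · exact iInf₂_le _ (isWeakDeriv_mderiv hD hF hv m)
  · refine le_iInf₂ fun g hg => le_of_eq ?_
    refine lintegral_congr_ae ?_
    filter_upwards [(isWeakDeriv_mderiv hD hF hv m).ae_eq hD hg] with x hx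
    rw [hx]

end Weak

/-! ### A Poincaré inequality on domains star-shaped with respect to a ball -/

section Poincare

theorem sq_lintegral_le {X : Type*} [MeasurableSpace X] (μ : Measure X) [IsProbabilityMeasure μ]
    {f : X → ℝ≥0∞} (hf : AEMeasurable f μ) : (∫⁻ x, f x ∂μ) ^ 2 ≤ ∫⁻ x, f x ^ 2 ∂μ := by
  have h := ENNReal.lintegral_mul_le_Lp_mul_Lq μ (p := 2) (q := 2) (by
    constructor <;> norm_num) hf (aemeasurable_const (b := (1 : ℝ≥0∞)))
  simp only [Pi.mul_apply, mul_one, ENNReal.one_rpow, lintegral_const, measure_univ] at h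
  calc (∫⁻ x, f x ∂μ) ^ 2 ≤ ((∫⁻ x, f x ^ (2 : ℝ) ∂μ) ^ (1 / 2 : ℝ)) ^ 2 := by gcongr
    _ = ∫⁻ x, f x ^ 2 ∂μ := by
      rw [← ENNReal.rpow_natCast, ← ENNReal.rpow_mul]
      norm_num

theorem lintegral_comp_affine {G : Plane → ℝ≥0∞} (hG : Measurable G) (c : Plane) {t : ℝ}
    (ht : 1 / 2 ≤ t) : ∫⁻ x, G (c + t • x) ≤ 4 * ∫⁻ x, G x := by
  have h0 : 0 < t := by linarith
  have hm : Measurable fun x => G (c + x) := hG.comp (measurable_const_add c)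
  have e := lintegral_map hm (measurable_const_smul t) (μ := (volume : Measure Plane))
  rw [← e, Measure.map_addHaar_smul volume h0.ne', lintegral_smul_measure,
    lintegral_add_left_eq_self, smul_eq_mul]
  gcongr
  rw [show (4 : ℝ≥0∞) = ENNReal.ofReal 4 by simp]
  apply ENNReal.ofReal_le_ofReal
  simp only [finrank_euclideanSpace, Fintype.card_fin]
  rw [abs_of_pos (by positivity), inv_le_comm₀ (by positivity) (by norm_num)]
  nlinarith

/-- The squared length of the classical gradient. -/
noncomputable def gradSq (w : Plane → ℝ) (x : Plane) : ℝ≥0∞ :=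
  ‖pderiv 0 w x‖ₑ ^ 2 + ‖pderiv 1 w x‖ₑ ^ 2

theorem measurable_pderiv (i : Fin 2) (w : Plane → ℝ) : Measurable (pderiv i w) :=
  measurable_fderiv_apply_const ℝ w _

theorem measurable_gradSq (w : Plane → ℝ) : Measurable (gradSq w) :=
  ((measurable_pderiv 0 w).enorm.pow_const 2).add ((measurable_pderiv 1 w).enorm.pow_const 2)

theorem enorm_fderiv_sq_le (w : Plane → ℝ) (x v : Plane) :
    ‖fderiv ℝ w x v‖ₑ ^ 2 ≤ ‖v‖ₑ ^ 2 * gradSq w x := by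
  have hv : v = v 0 • EuclideanSpace.single 0 1 + v 1 • EuclideanSpace.single 1 1 := by
    ext i; fin_cases i <;> simp
  have e : fderiv ℝ w x v = v 0 * pderiv 0 w x + v 1 * pderiv 1 w x := by
    conv_lhs => rw [hv]
    simp [pderiv]
  have hn : ‖v‖ ^ 2 = v 0 ^ 2 + v 1 ^ 2 := by
    rw [EuclideanSpace.norm_sq_eq]; simp
  have ofr : ∀ r : ℝ, ‖r‖ₑ ^ 2 = ENNReal.ofReal (r ^ 2) := fun r => by
    rw [← ofReal_norm, ← ENNReal.ofReal_pow (norm_nonneg _), Real.norm_eq_abs, sq_abs]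
  rw [gradSq, ofr, ofr, ofr, ← ofReal_norm v, ← ENNReal.ofReal_pow (norm_nonneg _), hn,
    ← ENNReal.ofReal_add (by positivity) (by positivity), ← ENNReal.ofReal_mul (by positivity), e]
  apply ENNReal.ofReal_le_ofReal
  nlinarith [sq_nonneg (v 0 * pderiv 1 w x - v 1 * pderiv 0 w x)]

/-- The fundamental theorem of calculus along the segment from `y` to `x`, then Cauchy–Schwarz in
`t`. The indicator makes the integrand a function on the whole plane, so that later affine
substitutions need not track the domain. -/
theorem enorm_sub_sq_le {D : Set Plane} {w : Plane → ℝ} (hD : IsOpen D)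
    (hw : ContDiffOn ℝ (⊤ : ℕ∞) w D) {x y : Plane} (hx : x ∈ D) (hy : StarConvex ℝ y D) :
    ‖w x - w y‖ₑ ^ 2
      ≤ edist x y ^ 2 * ∫⁻ t in Set.Ioc (0 : ℝ) 1, D.indicator (gradSq w) (y + t • (x - y)) := by
  have hmem : ∀ t ∈ Set.Icc (0 : ℝ) 1, y + t • (x - y) ∈ D := by
    intro t ht
    have := hy hx (a := 1 - t) (b := t) (by linarith [ht.2]) ht.1 (by ring)
    convert this using 1
    module
  have hpath : Continuous fun t : ℝ => y + t • (x - y) := by fun_prop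
  have hder : ∀ t ∈ Set.uIcc (0 : ℝ) 1, HasDerivAt (fun t : ℝ => w (y + t • (x - y)))
      (fderiv ℝ w (y + t • (x - y)) (x - y)) t := by
    intro t ht
    rw [Set.uIcc_of_le zero_le_one] at ht
    have h1 := (hw.differentiableAt_of_isOpen hD (hmem t ht)).hasFDerivAt
    have h2 : HasDerivAt (fun t : ℝ => y + t • (x - y)) (x - y) t := by
      simpa using ((hasDerivAt_id t).smul_const (x - y)).const_add y
    exact h1.comp_hasDerivAt t h2
  have hcont : ContinuousOn (fun t : ℝ => fderiv ℝ w (y + t • (x - y)) (x - y))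
      (Set.uIcc (0 : ℝ) 1) := by
    rw [Set.uIcc_of_le zero_le_one]
    refine ContinuousOn.clm_apply ?_ continuousOn_const
    exact (hw.fderiv_of_isOpen hD (m := (⊤ : ℕ∞)) (by simp)).continuousOn.comp hpath.continuousOn hmem
  have ftc := intervalIntegral.integral_eq_sub_of_hasDerivAt hder hcont.intervalIntegrable
  simp only [one_smul, zero_smul, add_zero, add_sub_cancel] at ftc
  rw [← ftc, intervalIntegral.integral_of_le zero_le_one]
  have hprob : IsProbabilityMeasure (volume.restrict (Set.Ioc (0 : ℝ) 1)) := ⟨by simp⟩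
  have hmeas : AEMeasurable (fun t : ℝ => ‖fderiv ℝ w (y + t • (x - y)) (x - y)‖ₑ)
      (volume.restrict (Set.Ioc (0 : ℝ) 1)) := by
    refine AEMeasurable.enorm ?_
    rw [Set.uIcc_of_le zero_le_one] at hcont
    exact (hcont.mono Set.Ioc_subset_Icc_self).aemeasurable measurableSet_Ioc
  calc ‖∫ t in Set.Ioc (0 : ℝ) 1, fderiv ℝ w (y + t • (x - y)) (x - y)‖ₑ ^ 2
      ≤ (∫⁻ t in Set.Ioc (0 : ℝ) 1, ‖fderiv ℝ w (y + t • (x - y)) (x - y)‖ₑ) ^ 2 := by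
        gcongr
        exact enorm_integral_le_lintegral_enorm _
    _ ≤ ∫⁻ t in Set.Ioc (0 : ℝ) 1, ‖fderiv ℝ w (y + t • (x - y)) (x - y)‖ₑ ^ 2 :=
        sq_lintegral_le _ hmeas
    _ ≤ ∫⁻ t in Set.Ioc (0 : ℝ) 1,
          edist x y ^ 2 * D.indicator (gradSq w) (y + t • (x - y)) := by
        refine setLIntegral_mono' measurableSet_Ioc fun t ht => ?_
        rw [Set.indicator_of_mem (hmem t (Set.Ioc_subset_Icc_self ht)), edist_eq_enorm_sub]
        exact enorm_fderiv_sq_le _ _ _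
    _ = _ := by
        rw [lintegral_const_mul']
        exact ENNReal.pow_ne_top (edist_ne_top _ _)

/-- Since `w` has mean zero on `B`, `w x` is the mean of `w x - w y` over `y ∈ B`. The segment
estimate leaves a triple integral of `G (y + t • (x - y))`. Splitting at `t = 1/2` keeps the
Jacobian bounded: on each half the integration is done first in the variable whose coefficient, `t`
or `1 - t`, is at least `1/2`. -/
theorem poincare {D B : Set Plane} {w : Plane → ℝ} (hD : IsOpen D)
    (hw : ContDiffOn ℝ (⊤ : ℕ∞) w D) (hB : IsCompact B) (hB0 : volume B ≠ 0)
    (hBD : B ⊆ D) (hstar : ∀ y ∈ B, StarConvex ℝ y D) {h R : ℝ≥0∞}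
    (hdiam : ∀ x ∈ D, ∀ y ∈ D, edist x y ≤ h) (hR : volume D ≤ R * volume B)
    (hmean : ∫ y in B, w y = 0) :
    ∫⁻ x in D, ‖w x‖ₑ ^ 2 ≤ h ^ 2 * (2 + 2 * R) * ∫⁻ x in D, gradSq w x := by
  set G : Plane → ℝ≥0∞ := D.indicator (gradSq w) with hGdef
  have hG : Measurable G := (measurable_gradSq w).indicator hD.measurableSet
  set I := ∫⁻ x in D, gradSq w x with hI
  have hGI : ∫⁻ x, G x = I := lintegral_indicator hD.measurableSet _
  have hBtop : volume B ≠ ⊤ := hB.measure_lt_top.ne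
  have hwB : IntegrableOn w B := (hw.continuousOn.mono hBD).integrableOn_compact hB
  have hfin : IsFiniteMeasure (volume.restrict B) := ⟨by simpa using hB.measure_lt_top⟩
  have hBm : MeasurableSet B := hB.isClosed.measurableSet
  have hprob : IsProbabilityMeasure ((volume B)⁻¹ • volume.restrict B) := ⟨by
    simp [ENNReal.inv_mul_cancel hB0 hBtop]⟩
  have hpt : ∀ x ∈ D, ‖w x‖ₑ ^ 2 ≤ (volume B)⁻¹ * (h ^ 2 *
      ∫⁻ y in B, ∫⁻ t in Set.Ioc (0 : ℝ) 1, G (y + t • (x - y))) := by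
    intro x hx
    have e : w x = ∫ y, (w x - w y) ∂((volume B)⁻¹ • volume.restrict B) := by
      rw [integral_smul_measure, integral_sub (integrable_const _) hwB, hmean]
      simp only [integral_const, measureReal_restrict_apply_univ, smul_eq_mul, sub_zero,
        ENNReal.toReal_inv]
      rw [← mul_assoc, Measure.real, inv_mul_cancel₀, one_mul]
      exact ENNReal.toReal_ne_zero.2 ⟨hB0, hBtop⟩
    have hm : AEMeasurable (fun y => ‖w x - w y‖ₑ) ((volume B)⁻¹ • volume.restrict B) :=
      ((aemeasurable_const.sub hwB.aemeasurable).enorm).smul_measure _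
    calc ‖w x‖ₑ ^ 2 ≤ (∫⁻ y, ‖w x - w y‖ₑ ∂((volume B)⁻¹ • volume.restrict B)) ^ 2 := by
          conv_lhs => rw [e]
          gcongr
          exact enorm_integral_le_lintegral_enorm _
      _ ≤ ∫⁻ y, ‖w x - w y‖ₑ ^ 2 ∂((volume B)⁻¹ • volume.restrict B) := sq_lintegral_le _ hm
      _ = (volume B)⁻¹ * ∫⁻ y in B, ‖w x - w y‖ₑ ^ 2 := by
          rw [lintegral_smul_measure, smul_eq_mul]
      _ ≤ (volume B)⁻¹ * ∫⁻ y in B, h ^ 2 *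
            ∫⁻ t in Set.Ioc (0 : ℝ) 1, G (y + t • (x - y)) := by
          refine mul_le_mul_right (setLIntegral_mono' hBm fun y hy => ?_) _
          refine (enorm_sub_sq_le hD hw hx (hstar y hy)).trans ?_
          gcongr
          exact hdiam x hx y (hBD hy)
      _ = _ := by
          rw [lintegral_const_mul]
          refine Measurable.lintegral_prod_right' (f := fun q : Plane × ℝ => G (q.1 + q.2 • (x - q.1))) ?_
          exact hG.comp (by fun_prop)
  -- Here `x` is scaled by `t > 1/2`: the Jacobian is at most 4 and the `t`-interval has length
  -- `1/2`, whence `2 * I`.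
  have hfar : ∫⁻ x in D, ∫⁻ y in B, ∫⁻ t in Set.Ioc (1 / 2 : ℝ) 1, G (y + t • (x - y))
      ≤ 2 * I * volume B := by
    rw [lintegral_lintegral_swap]
    · calc ∫⁻ y in B, ∫⁻ x in D, ∫⁻ t in Set.Ioc (1 / 2 : ℝ) 1, G (y + t • (x - y))
          ≤ ∫⁻ y in B, 2 * I := by
            refine lintegral_mono fun y => ?_
            rw [lintegral_lintegral_swap]
            · calc ∫⁻ t in Set.Ioc (1 / 2 : ℝ) 1, ∫⁻ x in D, G (y + t • (x - y))
                  ≤ ∫⁻ t in Set.Ioc (1 / 2 : ℝ) 1, 4 * I := by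
                    refine setLIntegral_mono' measurableSet_Ioc fun t ht => ?_
                    refine (setLIntegral_le_lintegral _ _).trans ?_
                    rw [← hGI]
                    refine (lintegral_congr fun x => ?_).trans_le
                      (lintegral_comp_affine hG ((1 - t) • y) ht.1.le)
                    congr 1
                    module
                _ = 2 * I := by
                    rw [setLIntegral_const, Real.volume_Ioc, mul_right_comm,
                      show (4 : ℝ≥0∞) = ENNReal.ofReal 4 by simp,
                      ← ENNReal.ofReal_mul (by norm_num)]
                    norm_num
            · exact (hG.comp (by fun_prop : Measurable fun q : Plane × ℝ =>
                y + q.2 • (q.1 - y))).aemeasurable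
        _ = 2 * I * volume B := setLIntegral_const _ _
    · refine Measurable.aemeasurable ?_
      refine Measurable.lintegral_prod_right' (f := fun q : (Plane × Plane) × ℝ =>
        G (q.1.2 + q.2 • (q.1.1 - q.1.2))) ?_
      exact hG.comp (by fun_prop)
  -- The roles of `x` and `y` are exchanged, with scaling `1 - t ≥ 1/2`; the remaining integral now
  -- runs over `D`, which is where `R` enters.
  have hnear : ∫⁻ x in D, ∫⁻ y in B, ∫⁻ t in Set.Ioc (0 : ℝ) (1 / 2), G (y + t • (x - y))
      ≤ 2 * I * volume D := by
    calc ∫⁻ x in D, ∫⁻ y in B, ∫⁻ t in Set.Ioc (0 : ℝ) (1 / 2), G (y + t • (x - y))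
        ≤ ∫⁻ x in D, 2 * I := by
          refine lintegral_mono fun x => ?_
          rw [lintegral_lintegral_swap]
          · calc ∫⁻ t in Set.Ioc (0 : ℝ) (1 / 2), ∫⁻ y in B, G (y + t • (x - y))
                ≤ ∫⁻ t in Set.Ioc (0 : ℝ) (1 / 2), 4 * I := by
                  refine setLIntegral_mono' measurableSet_Ioc fun t ht => ?_
                  refine (setLIntegral_le_lintegral _ _).trans ?_
                  rw [← hGI]
                  refine (lintegral_congr fun y => ?_).trans_le
                    (lintegral_comp_affine hG (t • x) (t := 1 - t) (by linarith [ht.2]))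
                  congr 1
                  module
              _ = 2 * I := by
                  rw [setLIntegral_const, Real.volume_Ioc, mul_right_comm,
                    show (4 : ℝ≥0∞) = ENNReal.ofReal 4 by simp,
                    ← ENNReal.ofReal_mul (by norm_num)]
                  norm_num
          · exact (hG.comp (by fun_prop : Measurable fun q : Plane × ℝ =>
              q.1 + q.2 • (x - q.1))).aemeasurable
      _ = 2 * I * volume D := setLIntegral_const _ _
  have hsplit : ∀ x y : Plane, ∫⁻ t in Set.Ioc (0 : ℝ) 1, G (y + t • (x - y))
      = (∫⁻ t in Set.Ioc (0 : ℝ) (1 / 2), G (y + t • (x - y)))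
        + ∫⁻ t in Set.Ioc (1 / 2 : ℝ) 1, G (y + t • (x - y)) := by
    intro x y
    rw [← lintegral_union measurableSet_Ioc (Set.Ioc_disjoint_Ioc_of_le le_rfl),
      Set.Ioc_union_Ioc_eq_Ioc (by norm_num) (by norm_num)]
  have hin : ∀ a b : ℝ, Measurable fun q : Plane × Plane =>
      ∫⁻ t in Set.Ioc a b, G (q.2 + t • (q.1 - q.2)) := by
    intro a b
    refine Measurable.lintegral_prod_right' (f := fun q : (Plane × Plane) × ℝ =>
        G (q.1.2 + q.2 • (q.1.1 - q.1.2))) ?_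
    exact hG.comp (by fun_prop)
  have hout : ∀ a b : ℝ, Measurable fun x : Plane =>
      ∫⁻ y in B, ∫⁻ t in Set.Ioc a b, G (y + t • (x - y)) := fun a b =>
    (hin a b).lintegral_prod_right'
  calc ∫⁻ x in D, ‖w x‖ₑ ^ 2
      ≤ ∫⁻ x in D, (volume B)⁻¹ * (h ^ 2 *
          ∫⁻ y in B, ∫⁻ t in Set.Ioc (0 : ℝ) 1, G (y + t • (x - y))) :=
        setLIntegral_mono' hD.measurableSet hpt
    _ = (volume B)⁻¹ * (h ^ 2 * ∫⁻ x in D,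
          ∫⁻ y in B, ∫⁻ t in Set.Ioc (0 : ℝ) 1, G (y + t • (x - y))) := by
        rw [lintegral_const_mul _ ((hout 0 1).const_mul _), lintegral_const_mul _ (hout 0 1)]
    _ = (volume B)⁻¹ * (h ^ 2 * ((∫⁻ x in D,
          ∫⁻ y in B, ∫⁻ t in Set.Ioc (0 : ℝ) (1 / 2), G (y + t • (x - y))) +
          ∫⁻ x in D, ∫⁻ y in B, ∫⁻ t in Set.Ioc (1 / 2 : ℝ) 1, G (y + t • (x - y)))) := by
        rw [← lintegral_add_left (hout _ _)]
        congr 3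
        ext x
        simp only [hsplit]
        exact lintegral_add_left ((hin 0 (1 / 2)).comp measurable_prodMk_left) _
    _ ≤ (volume B)⁻¹ * (h ^ 2 * (2 * I * (R * volume B) + 2 * I * volume B)) := by
        gcongr
        exact hnear.trans (by gcongr)
    _ = h ^ 2 * (2 + 2 * R) * I * ((volume B)⁻¹ * volume B) := by ring
    _ = _ := by rw [ENNReal.inv_mul_cancel hB0 hBtop, mul_one]

end Poincare

/-! ### Polynomials as functions on the plane -/

section Polynomials

/-- The function on the plane given by a polynomial in two variables. -/
noncomputable def evalPoly (P : MvPolynomial (Fin 2) ℝ) : Plane → ℝ :=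
  fun x => MvPolynomial.aeval (fun i => x i) P

theorem mem_polySpace {p : ℕ} {q : Plane → ℝ} :
    q ∈ polySpace p ↔ ∃ P : MvPolynomial (Fin 2) ℝ, P.totalDegree ≤ p ∧ evalPoly P = q := by
  simp only [polySpace, Submodule.mem_map, MvPolynomial.mem_restrictTotalDegree]
  rfl

theorem evalPoly_add (P Q : MvPolynomial (Fin 2) ℝ) :
    evalPoly (P + Q) = evalPoly P + evalPoly Q := by
  ext x; simp [evalPoly]

theorem hasFDerivAt_coord (i : Fin 2) (x : Plane) :
    HasFDerivAt (fun y : Plane => y i) (EuclideanSpace.proj i : Plane →L[ℝ] ℝ) x :=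
  (EuclideanSpace.proj i : Plane →L[ℝ] ℝ).hasFDerivAt

theorem contDiff_evalPoly (P : MvPolynomial (Fin 2) ℝ) :
    ContDiff ℝ (⊤ : ℕ∞) (evalPoly P) := by
  induction P using MvPolynomial.induction_on with
  | C a =>
    have : evalPoly (MvPolynomial.C a) = fun _ => a := by ext x; simp [evalPoly]
    rw [this]
    exact contDiff_const
  | add P Q hP hQ => rw [evalPoly_add]; exact hP.add hQ
  | mul_X P i hP =>
    have : evalPoly (P * MvPolynomial.X i) = fun x => evalPoly P x * x i := by
      ext x; simp [evalPoly]
    rw [this]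
    exact hP.mul (EuclideanSpace.proj i : Plane →L[ℝ] ℝ).contDiff

theorem pderiv_evalPoly (i : Fin 2) (P : MvPolynomial (Fin 2) ℝ) :
    pderiv i (evalPoly P) = evalPoly (MvPolynomial.pderiv i P) := by
  have hd : ∀ (P : MvPolynomial (Fin 2) ℝ) (x : Plane), DifferentiableAt ℝ (evalPoly P) x :=
    fun P x => (contDiff_evalPoly P).differentiable (by simp) x
  induction P using MvPolynomial.induction_on with
  | C a =>
    have : evalPoly (MvPolynomial.C a) = fun _ => a := by ext x; simp [evalPoly]
    rw [this]
    ext x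
    simp [pderiv, evalPoly]
  | add P Q hP hQ =>
    rw [map_add, evalPoly_add, evalPoly_add, ← hP, ← hQ]
    ext x
    simp only [pderiv, Pi.add_apply]
    rw [fderiv_add (hd P x) (hd Q x)]
    rfl
  | mul_X P j hP =>
    have : evalPoly (P * MvPolynomial.X j) = fun x => evalPoly P x * x j := by
      ext x; simp [evalPoly]
    rw [this]
    ext x
    have h := congrFun hP x
    simp only [pderiv] at h
    simp only [pderiv]
    rw [HasFDerivAt.fderiv (f := fun y : Plane => evalPoly P y * y j)
      ((hd P x).hasFDerivAt.mul (hasFDerivAt_coord j x))]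
    simp only [add_apply, smul_apply, smul_eq_mul, h]
    by_cases hij : i = j
    · subst hij; simp [evalPoly]
    · simp [evalPoly, MvPolynomial.pderiv_X, Ne.symm hij]

/-- The mixed partial derivative of multi-index `m` of a polynomial. -/
noncomputable def mixedDeriv (m : ℕ × ℕ) :
    MvPolynomial (Fin 2) ℝ →ₗ[ℝ] MvPolynomial (Fin 2) ℝ :=
  ((MvPolynomial.pderiv 0 : Derivation ℝ (MvPolynomial (Fin 2) ℝ) _).toLinearMap ^ m.1) ∘ₗ
    ((MvPolynomial.pderiv 1 : Derivation ℝ (MvPolynomial (Fin 2) ℝ) _).toLinearMap ^ m.2)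

theorem iterate_pderiv_evalPoly (i : Fin 2) (n : ℕ) (P : MvPolynomial (Fin 2) ℝ) :
    (pderiv i)^[n] (evalPoly P) = evalPoly
      (((MvPolynomial.pderiv i : Derivation ℝ (MvPolynomial (Fin 2) ℝ) _).toLinearMap ^ n) P) := by
  induction n generalizing P with
  | zero => rfl
  | succ n ih => rw [Function.iterate_succ_apply, pderiv_evalPoly, ih, pow_succ]; rfl

theorem mderiv_evalPoly (m : ℕ × ℕ) (P : MvPolynomial (Fin 2) ℝ) :
    mderiv m (evalPoly P) = evalPoly (mixedDeriv m P) := by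
  rw [mderiv, iterate_pderiv_evalPoly, iterate_pderiv_evalPoly]
  rfl

theorem pderiv_pow_monomial (i : Fin 2) (n : ℕ) (s : Fin 2 →₀ ℕ) (r : ℝ) :
    ((MvPolynomial.pderiv i : Derivation ℝ (MvPolynomial (Fin 2) ℝ) _).toLinearMap ^ n)
      (MvPolynomial.monomial s r) =
      MvPolynomial.monomial (s - Finsupp.single i n) (r * (s i).descFactorial n) := by
  induction n with
  | zero => simp
  | succ n ih =>
    rw [pow_succ', Module.End.mul_apply, ih]
    change MvPolynomial.pderiv i _ = _
    rw [MvPolynomial.pderiv_monomial]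
    congr 1
    · rw [tsub_tsub, ← Finsupp.single_add]
    · simp [Nat.descFactorial_succ]; ring

theorem mixedDeriv_monomial (m : ℕ × ℕ) (s : Fin 2 →₀ ℕ) (r : ℝ) :
    mixedDeriv m (MvPolynomial.monomial s r) =
      MvPolynomial.monomial (s - Finsupp.single 1 m.2 - Finsupp.single 0 m.1)
        (r * (s 1).descFactorial m.2 * (s 0).descFactorial m.1) := by
  rw [mixedDeriv, LinearMap.comp_apply, pderiv_pow_monomial, pderiv_pow_monomial]
  simp

theorem mixedDeriv_eq_zero {P : MvPolynomial (Fin 2) ℝ} {m : ℕ × ℕ}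
    (h : P.totalDegree < m.1 + m.2) : mixedDeriv m P = 0 := by
  rw [P.as_sum, map_sum]
  refine Finset.sum_eq_zero fun s hs => ?_
  have h1 := MvPolynomial.le_totalDegree hs
  rw [Finsupp.sum_fintype _ _ (by simp), Fin.sum_univ_two] at h1
  rw [mixedDeriv_monomial]
  rcases lt_or_ge (s 1) m.2 with h2 | h2
  · simp [Nat.descFactorial_of_lt h2]
  · simp [Nat.descFactorial_of_lt (show s 0 < m.1 by omega)]

/-- The monomials `x ^ a * y ^ b / (a! b!)` with `a + b = k` are dual to the derivatives of order
`k`. -/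
theorem exists_mixedDeriv_eq (k : ℕ) (c : ℕ × ℕ → ℝ) :
    ∃ P : MvPolynomial (Fin 2) ℝ, P.totalDegree ≤ k ∧
      ∀ m : ℕ × ℕ, m.1 + m.2 = k → mixedDeriv m P = MvPolynomial.C (c m) := by
  classical
  let e : ℕ × ℕ → (Fin 2 →₀ ℕ) := fun m => Finsupp.single 0 m.1 + Finsupp.single 1 m.2
  have e0 : ∀ m, e m 0 = m.1 := fun m => by simp [e]
  have e1 : ∀ m, e m 1 = m.2 := fun m => by simp [e]
  refine ⟨∑ m ∈ Finset.HasAntidiagonal.antidiagonal k,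
    MvPolynomial.monomial (e m) (c m / ((m.1.factorial : ℝ) * (m.2.factorial : ℝ))), ?_, ?_⟩
  · refine (MvPolynomial.totalDegree_finsetSum _ _).trans (Finset.sup_le fun m hm => ?_)
    refine (MvPolynomial.totalDegree_monomial_le _ _).trans ?_
    rw [Finset.HasAntidiagonal.mem_antidiagonal] at hm
    rw [Finsupp.sum_fintype _ (fun _ => id) (by simp), Fin.sum_univ_two, e0, e1]
    exact hm.le
  · intro m hm
    rw [map_sum (mixedDeriv m), Finset.sum_eq_single m]
    · rw [mixedDeriv_monomial, e0, e1, Nat.descFactorial_self, Nat.descFactorial_self,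
        MvPolynomial.C_apply]
      congr 1
      · congr 1; ext i; fin_cases i <;> simp [e]
      · have := Nat.factorial_ne_zero m.1
        have := Nat.factorial_ne_zero m.2
        field_simp
    · intro l hl hlm
      rw [Finset.HasAntidiagonal.mem_antidiagonal] at hl
      rw [mixedDeriv_monomial, e0, e1]
      rcases lt_trichotomy l.1 m.1 with h | h | h
      · simp [Nat.descFactorial_of_lt h]
      · exact absurd (Prod.ext h (by omega)) hlm
      · simp [Nat.descFactorial_of_lt (show l.2 < m.2 by omega)]
    · intro h
      exact absurd (Finset.HasAntidiagonal.mem_antidiagonal.2 hm) h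

end Polynomials

/-! ### Polynomial approximation on domains star-shaped with respect to a ball -/

section BrambleHilbert

variable {D B : Set Plane}

theorem mderiv_sub_evalPoly (hD : IsOpen D) {v : Plane → ℝ} (hv : ContDiffOn ℝ (⊤ : ℕ∞) v D)
    (P : MvPolynomial (Fin 2) ℝ) (m : ℕ × ℕ) :
    Set.EqOn (mderiv m (v - evalPoly P)) (mderiv m v - evalPoly (mixedDeriv m P)) D := by
  rw [← mderiv_evalPoly]
  exact mderiv_sub hD hv (contDiff_evalPoly P).contDiffOn m

/-- The means are corrected from the top order downwards: `Q` fixes order `k`, and the induction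
hypothesis for `v - Q` supplies lower-degree corrections that leave order `k` untouched. The
vanishing of derivatives of order at least `k` is carried separately because for `k = 0` the
truncated bound `k - 1` would still allow a nonzero constant. -/
theorem exists_evalPoly_integral_eq_zero (hD : IsOpen D) (hB : IsCompact B)
    (hB0 : volume B ≠ 0) (hBD : B ⊆ D) (k : ℕ) {v : Plane → ℝ}
    (hv : ContDiffOn ℝ (⊤ : ℕ∞) v D) :
    ∃ P : MvPolynomial (Fin 2) ℝ, P.totalDegree ≤ k - 1 ∧
      (∀ m : ℕ × ℕ, k ≤ m.1 + m.2 → mixedDeriv m P = 0) ∧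
      ∀ m : ℕ × ℕ, m.1 + m.2 < k → ∫ x in B, mderiv m (v - evalPoly P) x = 0 := by
  induction k generalizing v with
  | zero => exact ⟨0, by simp, by simp, by simp⟩
  | succ k ih =>
    obtain ⟨Q, hQ, hQc⟩ := exists_mixedDeriv_eq k
      fun m => (∫ x in B, mderiv m v x) / volume.real B
    obtain ⟨P, hP, hP0, hPi⟩ := ih (hv.sub (contDiff_evalPoly Q).contDiffOn)
    have e : v - evalPoly (Q + P) = v - evalPoly Q - evalPoly P := by
      rw [evalPoly_add, sub_sub]
    have hdeg : (Q + P).totalDegree ≤ k :=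
      (MvPolynomial.totalDegree_add _ _).trans (max_le hQ (by omega))
    refine ⟨Q + P, by simpa using hdeg, fun m hm => mixedDeriv_eq_zero (by omega),
      fun m hm => ?_⟩
    rcases Nat.lt_succ_iff_lt_or_eq.1 hm with h | h
    · rw [e]; exact hPi m h
    · have hBm : MeasurableSet B := hB.isClosed.measurableSet
      have hint : IntegrableOn (mderiv m v) B :=
        ((contDiffOn_mderiv hD hv m).continuousOn.mono hBD).integrableOn_compact hB
      have heq : Set.EqOn (mderiv m (v - evalPoly (Q + P)))
          (fun x => mderiv m v x - (∫ x in B, mderiv m v x) / volume.real B) B := by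
        intro x hx
        rw [mderiv_sub_evalPoly hD hv _ _ (hBD hx), map_add, hQc m h, hP0 m h.ge]
        simp [evalPoly]
      rw [setIntegral_congr_fun hBm heq, integral_sub hint
        (integrableOn_const hB.measure_lt_top.ne), setIntegral_const, smul_eq_mul,
        mul_div_cancel₀, sub_self]
      exact ENNReal.toReal_ne_zero.2 ⟨hB0, hB.measure_lt_top.ne⟩

/-- Each derivative of order `k + 1` arises at most twice, once by `∂₀` and once by `∂₁`. -/
theorem sum_setLIntegral_gradSq_mderiv_le (hD : IsOpen D) {w : Plane → ℝ}
    (hw : ContDiffOn ℝ (⊤ : ℕ∞) w D) (k : ℕ) :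
    ∑ m ∈ Finset.HasAntidiagonal.antidiagonal k, ∫⁻ x in D, gradSq (mderiv m w) x
      ≤ 2 * classicalSq (k + 1) D w := by
  let J : ℕ × ℕ → ℝ≥0∞ := fun m => ∫⁻ x in D, ‖mderiv m w x‖ₑ ^ 2
  have hterm : ∀ m : ℕ × ℕ, ∫⁻ x in D, gradSq (mderiv m w) x
      = J (m.1 + 1, m.2) + J (m.1, m.2 + 1) := by
    intro m
    simp only [gradSq]
    rw [lintegral_add_left ((measurable_pderiv 0 _).enorm.pow_const 2)]
    congr 1
    · rw [pderiv_zero_mderiv]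
    · exact setLIntegral_congr_fun hD.measurableSet fun x hx => by
        simp only [pderiv_one_mderiv hD hw m hx]
  rw [Finset.sum_congr rfl fun m _ => hterm m, Finset.sum_add_distrib, two_mul]
  refine add_le_add ?_ ?_
  · change _ ≤ ∑ m ∈ Finset.HasAntidiagonal.antidiagonal (k + 1), J m
    rw [Finset.Nat.sum_antidiagonal_succ]
    exact le_add_left le_rfl
  · change _ ≤ ∑ m ∈ Finset.HasAntidiagonal.antidiagonal (k + 1), J m
    rw [Finset.Nat.sum_antidiagonal_succ']
    exact le_add_left le_rfl

theorem volume_le_of_closedBall {z : Plane} {γ : ℝ} (hγ : 0 < γ) (hb : Bornology.IsBounded D)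
    (hz : z ∈ D) : volume D ≤ ENNReal.ofReal (4 / γ ^ 2) *
      volume (Metric.closedBall z (γ * Metric.diam D / 2)) := by
  have hsub : D ⊆ Metric.closedBall z (Metric.diam D) := fun x hx =>
    Metric.dist_le_diam_of_mem hb hx hz
  refine (measure_mono hsub).trans (le_of_eq ?_)
  have h0 : 0 ≤ Metric.diam D := Metric.diam_nonneg
  rw [Measure.addHaar_closedBall _ _ h0, Measure.addHaar_closedBall _ _ (by positivity),
    ← mul_assoc, ← ENNReal.ofReal_mul (by positivity)]
  congr 2
  simp only [finrank_euclideanSpace, Fintype.card_fin]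
  field_simp
  norm_num

/-- The **Bramble–Hilbert lemma** on a bounded domain star-shaped with respect to a ball of radius
proportional to the diameter. -/
theorem exists_polySpace_classicalSq_le {p : ℕ} {γ ρ : ℝ} {z : Plane} (hγ : 0 < γ)
    (hD : IsOpen D) (hb : Bornology.IsBounded D) (hne : D.Nonempty) (hdiam : 0 < Metric.diam D)
    (hρ : γ * Metric.diam D ≤ ρ) (hstar : ∀ y ∈ Metric.ball z ρ, StarConvex ℝ y D)
    {v : Plane → ℝ} (hv : ContDiffOn ℝ (⊤ : ℕ∞) v D) :
    ∃ q ∈ polySpace p, ContDiff ℝ (⊤ : ℕ∞) q ∧ classicalSq 1 D (v - q) ≤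
      ENNReal.ofReal (Metric.diam D ^ 2 * (4 + 16 / γ ^ 2)) ^ p * classicalSq (p + 1) D v := by
  set h := Metric.diam D with hh
  -- Half the guaranteed radius, so that the closed ball fits in the open ball of star centres.
  set B := Metric.closedBall z (γ * h / 2) with hBdef
  have hpos : 0 < γ * h := mul_pos hγ hdiam
  have hBball : B ⊆ Metric.ball z ρ := Metric.closedBall_subset_ball (by linarith)
  have hBD : B ⊆ D := fun y hy => (hstar y (hBball hy)).mem hne
  have hB : IsCompact B := isCompact_closedBall _ _
  have hB0 : volume B ≠ 0 := (Metric.measure_closedBall_pos _ _ (by linarith)).ne'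
  have hR := volume_le_of_closedBall hγ hb (hBD (Metric.mem_closedBall_self (by linarith)))
  -- With `p + 1`, means vanish up to order `p` included, so Poincaré applies at every order from 1
  -- to `p`, and derivatives of `P` of order `p + 1` vanish.
  obtain ⟨P, hP, hP0, hPi⟩ := exists_evalPoly_integral_eq_zero hD hB hB0 hBD (p + 1) hv
  have hw : ContDiffOn ℝ (⊤ : ℕ∞) (v - evalPoly P) D := hv.sub (contDiff_evalPoly P).contDiffOn
  set w := v - evalPoly P with hwdef
  have hedist : ∀ x ∈ D, ∀ y ∈ D, edist x y ≤ ENNReal.ofReal h := fun x hx y hy => by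
    rw [edist_dist]
    exact ENNReal.ofReal_le_ofReal (Metric.dist_le_diam_of_mem hb hx hy)
  have hconst : ENNReal.ofReal h ^ 2 * (2 + 2 * ENNReal.ofReal (4 / γ ^ 2)) * 2
      = ENNReal.ofReal (h ^ 2 * (4 + 16 / γ ^ 2)) := by
    rw [show (2 : ℝ≥0∞) = ENNReal.ofReal 2 by simp, ← ENNReal.ofReal_pow hdiam.le,
      ← ENNReal.ofReal_mul (by norm_num), ← ENNReal.ofReal_add (by norm_num) (by positivity),
      ← ENNReal.ofReal_mul (by positivity), ← ENNReal.ofReal_mul (by positivity)]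
    congr 1
    ring
  have hstep : ∀ k ≤ p, classicalSq k D w
      ≤ ENNReal.ofReal (h ^ 2 * (4 + 16 / γ ^ 2)) * classicalSq (k + 1) D w := by
    intro k hk
    calc classicalSq k D w
        ≤ ∑ m ∈ Finset.HasAntidiagonal.antidiagonal k,
            ENNReal.ofReal h ^ 2 * (2 + 2 * ENNReal.ofReal (4 / γ ^ 2)) *
              ∫⁻ x in D, gradSq (mderiv m w) x := by
          refine Finset.sum_le_sum fun m hm => ?_
          rw [Finset.HasAntidiagonal.mem_antidiagonal] at hm
          exact poincare hD (contDiffOn_mderiv hD hw m) hB hB0 hBD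
            (fun y hy => hstar y (hBball hy)) hedist hR (hPi m (by omega))
      _ ≤ ENNReal.ofReal h ^ 2 * (2 + 2 * ENNReal.ofReal (4 / γ ^ 2)) *
            (2 * classicalSq (k + 1) D w) := by
          rw [← Finset.mul_sum]
          gcongr
          exact sum_setLIntegral_gradSq_mderiv_le hD hw k
      _ = _ := by rw [← mul_assoc, hconst]
  have hiter : ∀ n ≤ p, classicalSq 1 D w
      ≤ ENNReal.ofReal (h ^ 2 * (4 + 16 / γ ^ 2)) ^ n * classicalSq (n + 1) D w := by
    intro n
    induction n with
    | zero => intro _; simp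
    | succ n ih =>
      intro hn
      refine (ih (by omega)).trans ?_
      rw [pow_succ (ENNReal.ofReal _), mul_assoc]
      exact mul_le_mul_right (hstep (n + 1) hn) _
  refine ⟨evalPoly P, mem_polySpace.2 ⟨P, by simpa using hP, rfl⟩, contDiff_evalPoly P, ?_⟩
  refine (hiter p le_rfl).trans (le_of_eq ?_)
  congr 1
  refine Finset.sum_congr rfl fun m hm => setLIntegral_congr_fun hD.measurableSet fun x hx => ?_
  rw [Finset.HasAntidiagonal.mem_antidiagonal] at hm
  simp only [hwdef, mderiv_sub_evalPoly hD hv P m hx, hP0 m hm.ge]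
  simp [evalPoly]

end BrambleHilbert

/-! ### The singular function in complex notation -/

section Singular

/-- The complex coordinate centred at `A`. -/
noncomputable def complexCoord (A x : Plane) : ℂ := ⟨x 0 - A 0, x 1 - A 1⟩

theorem complexCoord_add_smul_dir (A : Plane) (r t : ℝ) :
    complexCoord A (A + r • dir t) = r * Complex.exp (t * Complex.I) := by
  apply Complex.ext
  · rw [Complex.re_ofReal_mul, Complex.exp_ofReal_mul_I_re]
    simp [complexCoord, dir]
  · rw [Complex.im_ofReal_mul, Complex.exp_ofReal_mul_I_im]
    simp [complexCoord, dir]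

theorem contDiff_complexCoord (A : Plane) : ContDiff ℝ (⊤ : ℕ∞) (complexCoord A) := by
  have e : complexCoord A = fun x : Plane =>
      ((x 0 - A 0 : ℝ) : ℂ) + ((x 1 - A 1 : ℝ) : ℂ) * Complex.I := by
    ext x
    apply Complex.ext <;> simp [complexCoord]
  have hc : ∀ i : Fin 2, ContDiff ℝ (⊤ : ℕ∞) fun x : Plane => ((x i - A i : ℝ) : ℂ) := fun i =>
    Complex.ofRealCLM.contDiff.comp
      ((EuclideanSpace.proj i : Plane →L[ℝ] ℝ).contDiff.sub contDiff_const)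
  rw [e]
  exact (hc 0).add ((hc 1).mul contDiff_const)

theorem complexCoord_ne_zero {A x : Plane} (h : x ≠ A) : complexCoord A x ≠ 0 := by
  intro h0
  apply h
  have h1 := congrArg Complex.re h0
  have h2 := congrArg Complex.im h0
  simp only [complexCoord, Complex.zero_re, Complex.zero_im] at h1 h2
  ext i
  fin_cases i
  · exact sub_eq_zero.1 h1
  · exact sub_eq_zero.1 h2

/-- A quotient `-s ≤ 0` would place `A` on the segment from `z` to `x`, hence in `D`. -/
theorem div_complexCoord_mem_slitPlane {D : Set Plane} {A x z : Plane} (hz : StarConvex ℝ z D)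
    (hA : A ∉ D) (hx : x ∈ D) : complexCoord A x / complexCoord A z ∈ Complex.slitPlane := by
  have hzD : z ∈ D := hz.mem ⟨x, hx⟩
  have hz0 : complexCoord A z ≠ 0 := complexCoord_ne_zero fun h => hA (h ▸ hzD)
  rw [Complex.mem_slitPlane_iff]
  by_contra! hcon
  obtain ⟨hre, him⟩ := hcon
  set s := -(complexCoord A x / complexCoord A z).re with hs
  have hs0 : 0 ≤ s := by linarith
  have e : complexCoord A x = -(s : ℂ) * complexCoord A z := by
    rw [← div_eq_iff hz0]
    apply Complex.ext <;> simp [hs, him]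
  apply hA
  have key := hz hx (a := s / (1 + s)) (b := 1 / (1 + s)) (by positivity) (by positivity)
    (by field_simp; ring)
  convert key using 1
  have h1 := congrArg Complex.re e
  have h2 := congrArg Complex.im e
  simp only [complexCoord, ← Complex.ofReal_neg, Complex.re_ofReal_mul, Complex.im_ofReal_mul]
    at h1 h2
  have hs1 : 1 + s ≠ 0 := by positivity
  ext i
  fin_cases i
  · simp only [Fin.zero_eta, PiLp.add_apply, PiLp.smul_apply, smul_eq_mul]
    field_simp
    linarith
  · simp only [Fin.mk_one, PiLp.add_apply, PiLp.smul_apply, smul_eq_mul]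
    field_simp
    linarith

/-- With `ζ = log r + i t`, both cases are imaginary parts of entire functions of `ζ`, so smoothness
reduces to that of a branch of the logarithm. -/
theorem singular_eq_im {α r t : ℝ} (hr : 0 < r) (ζ : ℂ) (hre : ζ.re = Real.log r)
    (him : ζ.im = t) : singular α r t =
      (open Classical in if ∃ m : ℕ, α = m then (ζ * Complex.exp (α * ζ)).im
        else (Complex.exp (α * ζ)).im) := by
  have e : Complex.exp (α * ζ) = ⟨r ^ α * Real.cos (α * t), r ^ α * Real.sin (α * t)⟩ := by
    apply Complex.ext
    · rw [Complex.exp_re, Real.rpow_def_of_pos hr]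
      simp [hre, him, mul_comm]
    · rw [Complex.exp_im, Real.rpow_def_of_pos hr]
      simp [hre, him, mul_comm]
  rw [singular, e]
  split_ifs with h
  · rw [Complex.mul_im, hre, him]
    ring
  · rfl

/-- Values of `g` differ by multiples of `2π`, while its image is an interval; if `g` were not
constant, it would take two distinct values at distance at most `π`. -/
theorem eqOn_const_of_exp_eq {S : Set Plane} (hS : IsPreconnected S) {g : Plane → ℝ}
    (hg : ContinuousOn g S) {K : ℂ} (h : ∀ x ∈ S, Complex.exp (g x * Complex.I) = K)
    {x y : Plane} (hx : x ∈ S) (hy : y ∈ S) : g x = g y := by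
  have hord : (g '' S).OrdConnected := (hS.image g hg).ordConnected
  have key : ∀ x ∈ S, ∀ y ∈ S, ¬ g x < g y := by
    intro x hx y hy hlt
    have hmem : min (g y) (g x + Real.pi) ∈ g '' S :=
      hord.out ⟨x, hx, rfl⟩ ⟨y, hy, rfl⟩
        ⟨le_min hlt.le (by linarith [Real.pi_pos]), min_le_left _ _⟩
    obtain ⟨w, hw, hwe⟩ := hmem
    have hlt' : g x < g w := hwe ▸ lt_min hlt (by linarith [Real.pi_pos])
    have hle' : g w ≤ g x + Real.pi := hwe ▸ min_le_right _ _
    have he : Complex.exp ((g w - g x : ℝ) * Complex.I) = 1 := by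
      rw [Complex.ofReal_sub, sub_mul, Complex.exp_sub, h w hw, h x hx, div_self]
      rw [← h x hx]
      exact Complex.exp_ne_zero _
    have hc : Real.cos (g w - g x) = 1 := by
      rw [← Complex.exp_ofReal_mul_I_re, he, Complex.one_re]
    rw [Real.cos_eq_one_iff_of_lt_of_lt (by linarith [Real.pi_pos]) (by linarith [Real.pi_pos])]
      at hc
    linarith
  exact le_antisymm (not_lt.1 (key y hy x hx)) (not_lt.1 (key x hx y hy))

/-- Off the vertex, the singular function extends smoothly across the cracks of a star-shaped
region. -/
theorem exists_contDiffOn_eqOn_singularAt {D E Ω : Set Plane} {A z : Plane} {β ω α : ℝ}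
    {θ : Plane → ℝ} (hv : IsVertex Ω A β ω θ) (hz : StarConvex ℝ z D) (hA : A ∉ D)
    (hED : E ⊆ D) (hEΩ : E ⊆ Ω) (hE : IsConnected E) :
    ∃ F : Plane → ℝ, ContDiffOn ℝ (⊤ : ℕ∞) F D ∧ Set.EqOn F (singularAt A θ α 1) E := by
  classical
  obtain ⟨x₀, hx₀⟩ := hE.nonempty
  have hzD : z ∈ D := hz.mem ⟨x₀, hED hx₀⟩
  have hne : ∀ x ∈ D, complexCoord A x ≠ 0 := fun x hx =>
    complexCoord_ne_zero fun h => hA (h ▸ hx)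
  -- Dividing by the coordinate of `z` turns the ray missed by `D` into the cut of the principal
  -- logarithm.
  let Q : Plane → ℂ := fun x => complexCoord A x / complexCoord A z
  have hQs : ∀ x ∈ D, Q x ∈ Complex.slitPlane := fun x hx =>
    div_complexCoord_mem_slitPlane hz hA hx
  have hQsm : ContDiff ℝ (⊤ : ℕ∞) Q := (contDiff_complexCoord A).div_const _
  have hlog : ContDiffOn ℝ (⊤ : ℕ∞) (fun x => Complex.log (Q x)) D := fun x hx =>
    (((Complex.contDiffAt_log (hQs x hx)).restrict_scalars ℝ).comp x
      hQsm.contDiffAt).contDiffWithinAt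
  have hpolar : ∀ x ∈ E, 0 < dist x A ∧
      complexCoord A x = dist x A * Complex.exp ((β + θ x : ℝ) * Complex.I) := by
    intro x hx
    refine ⟨dist_pos.2 fun h => hA (h ▸ hED hx), ?_⟩
    conv_lhs => rw [hv.polar x (hEΩ hx)]
    exact complexCoord_add_smul_dir _ _ _
  have hnorm : ∀ x ∈ E, ‖complexCoord A x‖ = dist x A := fun x hx => by
    rw [(hpolar x hx).2, norm_mul, Complex.norm_exp_ofReal_mul_I, mul_one, Complex.norm_real,
      Real.norm_of_nonneg dist_nonneg]
  -- The difference of two continuous angle functions; it is constant because `E` is connected.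
  let g : Plane → ℝ := fun x => θ x - (Q x).arg
  have hgc : ContinuousOn g E := by
    refine (hv.continuousOn.mono hEΩ).sub fun x hx => ?_
    exact ((Complex.continuousAt_arg (hQs x (hED hx))).comp
      hQsm.continuous.continuousAt).continuousWithinAt
  have hgK : ∀ x ∈ E, Complex.exp (g x * Complex.I) =
      complexCoord A z / ‖complexCoord A z‖ * Complex.exp (-β * Complex.I) := by
    intro x hx
    obtain ⟨hr, hp⟩ := hpolar x hx
    have hr' : (dist x A : ℂ) ≠ 0 := Complex.ofReal_ne_zero.2 hr.ne'
    have hz0 := hne z hzD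
    have hz1 : (‖complexCoord A z‖ : ℂ) ≠ 0 := Complex.ofReal_ne_zero.2 (norm_ne_zero_iff.2 hz0)
    have ha := Complex.norm_mul_exp_arg_mul_I (Q x)
    have hQn : ‖Q x‖ = dist x A / ‖complexCoord A z‖ := by
      rw [norm_div, hnorm x hx]
    have hQv : Q x = complexCoord A x / complexCoord A z := rfl
    have ea := Complex.exp_ne_zero ((Q x).arg * Complex.I)
    have eb := Complex.exp_ne_zero (β * Complex.I)
    simp only [g]
    generalize (Q x).arg = ψ at ha ea ⊢
    rw [hQn, hQv, hp, Complex.ofReal_div] at ha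
    simp only [ Complex.ofReal_sub, sub_mul, Complex.exp_sub, neg_mul, Complex.exp_neg]
    rw [Complex.ofReal_add, add_mul, Complex.exp_add] at ha
    field_simp at ha ⊢
    linear_combination -ha
  -- This constant makes `log Q + c` equal to `log r + i θ` on `E`.
  let c : ℂ := ⟨Real.log ‖complexCoord A z‖, g x₀⟩
  let L : Plane → ℂ := fun x => Complex.log (Q x) + c
  have hL : ContDiffOn ℝ (⊤ : ℕ∞) L D := hlog.add contDiffOn_const
  have hexp : ContDiffOn ℝ (⊤ : ℕ∞) (fun x => Complex.exp (α * L x)) D :=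
    (contDiffOn_const.mul hL).cexp
  refine ⟨fun x => if ∃ m : ℕ, α = m then (L x * Complex.exp (α * L x)).im
        else (Complex.exp (α * L x)).im, ?_, ?_⟩
  · split_ifs
    · exact Complex.imCLM.contDiff.comp_contDiffOn (hL.mul hexp)
    · exact Complex.imCLM.contDiff.comp_contDiffOn hexp
  · intro x hx
    have hr := (hpolar x hx).1
    have hz0 : ‖complexCoord A z‖ ≠ 0 := norm_ne_zero_iff.2 (hne z hzD)
    simp only [singularAt, div_one]
    refine (singular_eq_im hr (L x) ?_ ?_).symm
    · simp only [L, c, Complex.add_re, Complex.log_re]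
      rw [norm_div, Real.log_div (by rw [hnorm x hx]; exact hr.ne') hz0, hnorm x hx]
      ring
    · simp only [L, c, Complex.add_im, Complex.log_im]
      rw [← eqOn_const_of_exp_eq hE.isPreconnected hgc hgK hx hx₀]
      simp [g]

theorem polySpace_mono {m n : ℕ} (h : m ≤ n) : polySpace m ≤ polySpace n := by
  intro q hq
  obtain ⟨P, hP, rfl⟩ := mem_polySpace.1 hq
  exact mem_polySpace.2 ⟨P, hP.trans h, rfl⟩

theorem mul_mem_polySpace {m n : ℕ} {f g : Plane → ℝ} (hf : f ∈ polySpace m)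
    (hg : g ∈ polySpace n) : f * g ∈ polySpace (m + n) := by
  obtain ⟨P, hP, rfl⟩ := mem_polySpace.1 hf
  obtain ⟨Q, hQ, rfl⟩ := mem_polySpace.1 hg
  refine mem_polySpace.2 ⟨P * Q, (MvPolynomial.totalDegree_mul _ _).trans (by omega), ?_⟩
  ext x
  simp [evalPoly]

theorem const_mem_polySpace (n : ℕ) (a : ℝ) : (fun _ => a) ∈ polySpace n := by
  refine mem_polySpace.2 ⟨MvPolynomial.C a, by simp, ?_⟩
  ext x
  simp [evalPoly]

theorem coord_sub_mem_polySpace (i : Fin 2) (a : ℝ) :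
    (fun x : Plane => x i - a) ∈ polySpace 1 := by
  refine sub_mem (mem_polySpace.2 ⟨MvPolynomial.X i, by simp, ?_⟩) (const_mem_polySpace 1 a)
  ext x
  simp [evalPoly]

theorem pow_complexCoord_mem_polySpace (A : Plane) (c : ℂ) (m : ℕ) :
    (fun x => ((c * complexCoord A x) ^ m).re) ∈ polySpace m ∧
      (fun x => ((c * complexCoord A x) ^ m).im) ∈ polySpace m := by
  have hre : (fun x => (c * complexCoord A x).re) ∈ polySpace 1 :=
    sub_mem ((polySpace 1).smul_mem c.re (coord_sub_mem_polySpace 0 (A 0)))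
      ((polySpace 1).smul_mem c.im (coord_sub_mem_polySpace 1 (A 1)))
  have him : (fun x => (c * complexCoord A x).im) ∈ polySpace 1 :=
    add_mem ((polySpace 1).smul_mem c.re (coord_sub_mem_polySpace 1 (A 1)))
      ((polySpace 1).smul_mem c.im (coord_sub_mem_polySpace 0 (A 0)))
  induction m with
  | zero => simpa using ⟨const_mem_polySpace 0 1, const_mem_polySpace 0 0⟩
  | succ m ih =>
    simp only [pow_succ, Complex.mul_re (_ ^ m), Complex.mul_im (_ ^ m)]
    exact ⟨sub_mem (mul_mem_polySpace ih.1 hre) (mul_mem_polySpace ih.2 him),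
      add_mem (mul_mem_polySpace ih.1 him) (mul_mem_polySpace ih.2 hre)⟩

/-- Rescaling the radius changes the singular function by a factor and a polynomial. -/
theorem singularAt_one_eq {Ω : Set Plane} {A : Plane} {β ω α h : ℝ} {θ : Plane → ℝ}
    (hv : IsVertex Ω A β ω θ) (hA : A ∉ Ω) {p : ℕ} (hα : (∃ m : ℕ, α = m) → α ≤ p)
    (hh : 0 < h) : ∃ a : ℝ, ∃ g ∈ polySpace p,
      ∀ x ∈ Ω, singularAt A θ α 1 x = a * singularAt A θ α h x + g x := by
  have hscale : ∀ x, (dist x A / h) ^ α = dist x A ^ α / h ^ α := fun x =>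
    Real.div_rpow dist_nonneg hh.le α
  have hhα : h ^ α ≠ 0 := (Real.rpow_pos_of_pos hh α).ne'
  by_cases hm : ∃ m : ℕ, α = m
  · obtain ⟨m, rfl⟩ := hm
    have hmp : m ≤ p := by exact_mod_cast hα ⟨m, rfl⟩
    -- From `log (r / h) = log r - log h`, the correction is `log h * r ^ m * sin (m θ)`. The
    -- rotation by `-β` makes the complex argument equal to `θ`.
    refine ⟨h ^ (m : ℝ), _, (polySpace p).smul_mem (Real.log h) (polySpace_mono hmp
      (pow_complexCoord_mem_polySpace A (Complex.exp (-β * Complex.I)) m).2), fun x hx => ?_⟩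
    have hr : dist x A ≠ 0 := dist_ne_zero.2 fun h => hA (h ▸ hx)
    have hpoly : ((Complex.exp (-β * Complex.I) * complexCoord A x) ^ m).im
        = dist x A ^ (m : ℝ) * Real.sin (m * θ x) := by
      have e : Complex.exp (-β * Complex.I) * complexCoord A x
          = dist x A * Complex.exp (θ x * Complex.I) := by
        conv_lhs => rw [hv.polar x hx]
        rw [complexCoord_add_smul_dir, mul_left_comm, ← Complex.exp_add]
        congr 2
        push_cast
        ring
      rw [e, mul_pow, ← Complex.exp_nat_mul, ← Complex.ofReal_pow, Complex.im_ofReal_mul,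
        Real.rpow_natCast, ← mul_assoc]
      congr 1
      exact_mod_cast Complex.exp_ofReal_mul_I_im (m * θ x)
    simp only [singularAt, singular, Pi.smul_apply, smul_eq_mul, hpoly, div_one]
    rw [if_pos ⟨m, rfl⟩, if_pos ⟨m, rfl⟩, hscale, Real.log_div hr hh.ne']
    field_simp
    ring
  · refine ⟨h ^ α, 0, zero_mem _, fun x _ => ?_⟩
    simp only [singularAt, singular, if_neg hm, hscale, div_one, Pi.zero_apply]
    field_simp
    ring

end Singular

/-! ### Elements of the mesh -/

section Mesh

theorem volume_segment (a b : Plane) : volume (segment ℝ a b) = 0 := by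
  refine measure_mono_null (t := (affineSpan ℝ {a, b} : Set Plane)) ?_ ?_
  · rw [← convexHull_pair]
    exact convexHull_subset_affineSpan _
  · refine Measure.addHaar_affineSubspace volume _ fun h => ?_
    have h1 := (collinear_iff_finrank_le_one (k := ℝ)).1 (collinear_pair ℝ a b)
    rw [← direction_affineSpan, h, AffineSubspace.direction_top, finrank_top,
      finrank_euclideanSpace, Fintype.card_fin] at h1
    omega

theorem IsPolygonalDomain.volume_frontier {Ω : Set Plane} (hΩ : IsPolygonalDomain Ω) :
    volume (frontier Ω) = 0 := by
  obtain ⟨s, _, hs⟩ := hΩ.frontier_eq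
  rw [hs]
  exact (measure_biUnion_null_iff s.countable_toSet).2 fun e _ => volume_segment _ _

theorem IsVertex.notMem {Ω : Set Plane} {A : Plane} {β ω : ℝ} {θ : Plane → ℝ}
    (hv : IsVertex Ω A β ω θ) (hΩ : IsOpen Ω) : A ∉ Ω := by
  obtain ⟨ρ, hρ, _, h⟩ := hv.sector
  have := (h 0 le_rfl hρ).1
  rw [zero_smul, add_zero, hΩ.frontier_eq] at this
  exact this.2

theorem Polygon.size_pos (P : Polygon) : 0 < P.size := by
  obtain ⟨x, hx⟩ := P.isConnected.nonempty
  obtain ⟨y, hy, hyx⟩ := (infinite_of_mem_nhds x (P.isOpen.mem_nhds hx)).nontrivial.exists_ne x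
  exact (dist_pos.2 hyx).trans_le (Metric.dist_le_diam_of_mem P.isBounded hy hx)

variable {Ω : Set Plane} {N : ℕ} {T : Fin N → Polygon}

theorem IsMesh.region_subset (hT : IsMesh Ω T) (k : Fin N) : (T k).region ⊆ closure Ω := by
  rw [← hT.cover]
  exact subset_closure.trans (Set.subset_iUnion (fun k => closure (T k).region) k)

/-- What is removed lies in `closure Ω \ Ω`, a finite union of segments. -/
theorem IsMesh.element_ae_eq (hΩ : IsPolygonalDomain Ω) (hT : IsMesh Ω T) (k : Fin N) :
    element Ω T k =ᵐ[volume] (T k).region := by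
  refine (LE.le.eventuallyLE Set.inter_subset_left).antisymm ?_
  rw [ae_le_set]
  refine measure_mono_null (fun x hx => ?_) hΩ.volume_frontier
  rw [hΩ.isOpen.frontier_eq]
  exact ⟨hT.region_subset k hx.1, fun h => hx.2 ⟨hx.1, h⟩⟩

theorem size_le_meshSize (T : Fin N → Polygon) (k : Fin N) : (T k).size ≤ meshSize T :=
  le_ciSup (f := fun k => (T k).size) (Set.finite_range _).bddAbove k

/-- Polynomial approximation on an element, for functions smooth across the cracks. -/
theorem exists_polySpace_sobolevSq_le (hΩ : IsPolygonalDomain Ω) (hT : IsMesh Ω T) {γ : ℝ}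
    (hγ : 0 < γ) (hreg : IsRegularMesh γ T) (p : ℕ) (k : Fin N) {F v : Plane → ℝ}
    (hF : ContDiffOn ℝ (⊤ : ℕ∞) F (T k).region)
    (hv : v =ᵐ[volume.restrict (element Ω T k)] F) :
    ∃ q ∈ polySpace p, sobolevSq 1 (element Ω T k) (v - q) ≤
      ENNReal.ofReal (meshSize T ^ 2 * (4 + 16 / γ ^ 2)) ^ p *
        sobolevSq (p + 1) (element Ω T k) v := by
  obtain ⟨z, ρ, hρ, hstar⟩ := hreg.starShaped k
  have hsize := (T k).size_pos
  obtain ⟨q, hq, hqs, hle⟩ := exists_polySpace_classicalSq_le (p := p) hγ (T k).isOpen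
    (T k).isBounded (T k).isConnected.nonempty hsize hρ hstar hF
  have hE : IsOpen (element Ω T k) := (T k).isOpen.inter hΩ.isOpen
  have hsub : element Ω T k ⊆ (T k).region := Set.inter_subset_left
  -- This passes from the cracked element, generally not star-shaped, to the whole polygon.
  have hcl : ∀ s G, classicalSq s (element Ω T k) G = classicalSq s (T k).region G := fun s G => by
    simp only [classicalSq, Measure.restrict_congr_set (hT.element_ae_eq hΩ k)]
  refine ⟨q, hq, ?_⟩
  have hvq : v - q =ᵐ[volume.restrict (element Ω T k)] F - q := hv.sub (ae_eq_refl q)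
  rw [sobolevSq_eq_classicalSq hE ((hF.sub hqs.contDiffOn).mono hsub) hvq,
    sobolevSq_eq_classicalSq hE (hF.mono hsub) hv, hcl, hcl]
  refine hle.trans ?_
  gcongr
  exact size_le_meshSize T k

theorem sobolevSq_le_of_ae_eq {D : Set Plane} {v w : Plane → ℝ}
    (h : v =ᵐ[volume.restrict D] w) (s : ℕ) : sobolevSq s D v ≤ sobolevSq s D w := by
  refine Finset.sum_le_sum fun m _ => le_iInf₂ fun g hg => iInf₂_le g ?_
  refine ⟨fun x hx => ?_, hg.locallyIntegrable_deriv, fun φ hφ => ?_⟩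
  · obtain ⟨U, hU, hU'⟩ := hg.locallyIntegrable x hx
    refine ⟨U ∩ D, inter_mem hU self_mem_nhdsWithin, ?_⟩
    refine (hU'.mono_set Set.inter_subset_left).congr_fun_ae ?_
    exact ae_mono (Measure.restrict_mono Set.inter_subset_right le_rfl) h.symm
  · rw [← hg.integral_eq φ hφ]
    refine integral_congr_ae ?_
    filter_upwards [h] with x hx
    rw [hx]

/-- The common factor is the square of `√K ^ p * h ^ p`, and the square root is subadditive. -/
theorem rpow_half_sum_le {ι : Type*} [Fintype ι] [DecidableEq ι] {a b₁ b₂ : ι → ℝ≥0∞}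
    {s t : Finset ι} (hst : Disjoint s t) (hu : s ∪ t = Finset.univ) {h K : ℝ} (hh : 0 ≤ h)
    (hK : 0 ≤ K) {p : ℕ} (h₁ : ∀ k ∈ s, a k ≤ ENNReal.ofReal (h ^ 2 * K) ^ p * b₁ k)
    (h₂ : ∀ k ∈ t, a k ≤ ENNReal.ofReal (h ^ 2 * K) ^ p * b₂ k) :
    (∑ k, a k) ^ (1 / 2 : ℝ) ≤ ENNReal.ofReal (√K ^ p * h ^ p) *
      ((∑ k ∈ s, b₁ k) ^ (1 / 2 : ℝ) + (∑ k ∈ t, b₂ k) ^ (1 / 2 : ℝ)) := by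
  have hM : ENNReal.ofReal (h ^ 2 * K) ^ p = ENNReal.ofReal (√K ^ p * h ^ p) ^ (2 : ℝ) := by
    rw [← ENNReal.ofReal_pow (by positivity), ENNReal.ofReal_rpow_of_nonneg (by positivity)
      (by norm_num), Real.rpow_two]
    congr 1
    rw [← mul_pow, ← pow_mul, mul_comm p 2, pow_mul, mul_pow (√K), Real.sq_sqrt hK, mul_comm K]
  calc (∑ k, a k) ^ (1 / 2 : ℝ)
      ≤ (ENNReal.ofReal (√K ^ p * h ^ p) ^ (2 : ℝ) *
          (∑ k ∈ s, b₁ k + ∑ k ∈ t, b₂ k)) ^ (1 / 2 : ℝ) := by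
        gcongr
        rw [← hu, Finset.sum_union hst, mul_add, Finset.mul_sum, Finset.mul_sum, ← hM]
        exact add_le_add (Finset.sum_le_sum h₁) (Finset.sum_le_sum h₂)
    _ = ENNReal.ofReal (√K ^ p * h ^ p) *
          (∑ k ∈ s, b₁ k + ∑ k ∈ t, b₂ k) ^ (1 / 2 : ℝ) := by
        rw [ENNReal.mul_rpow_of_nonneg _ _ (by norm_num), ← ENNReal.rpow_mul]
        norm_num
    _ ≤ _ := by
        gcongr
        exact ENNReal.rpow_add_le_add_rpow _ _ (by norm_num) (by norm_num)

end Mesh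

end EnrichedVEM

/-! ### Assembly of the global estimate -/

open EnrichedVEM

theorem lemma4p2 (p : ℕ) (hp : 1 ≤ p) (γ : ℝ) (hγ0 : 0 < γ) (hγ1 : γ < 1) :
    ∃ c : ℝ, 0 < c ∧
      ∀ (Ω : Set EnrichedVEM.Plane), EnrichedVEM.IsPolygonalDomain Ω →
      -- the singular vertex, its polar coordinates, and the singular exponent
      ∀ (A : EnrichedVEM.Plane) (β ω : ℝ) (θ : EnrichedVEM.Plane → ℝ),
        EnrichedVEM.IsVertex Ω A β ω θ →
      ∀ (j : ℕ), 1 ≤ j → ∀ (α : ℝ), α = j * Real.pi / ω →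
        ((∃ m : ℕ, α = m) → α ≤ p) →
      -- the solution and its decomposition
      ∀ (f u u₀ : EnrichedVEM.Plane → ℝ) (κ : ℝ),
        AnalyticOnNhd ℝ f Ω → MeasureTheory.MemLp f 2 (MeasureTheory.volume.restrict Ω) →
        EnrichedVEM.IsWeakSolution Ω f u →
        AnalyticOnNhd ℝ u₀ (closure Ω) →
        (∀ᵐ x ∂(MeasureTheory.volume.restrict Ω),
          u x = u₀ x + κ * EnrichedVEM.singularAt A θ α 1 x) →
      -- the mesh and its layers
      ∀ (N : ℕ) (T : Fin N → EnrichedVEM.Polygon) (γ' : ℝ), 0 < γ' →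
        EnrichedVEM.IsMesh Ω T → EnrichedVEM.IsRegularMesh γ T →
        (∀ k, A ∈ (T k).region → k ∈ EnrichedVEM.layer1 Ω A γ' T) →
      ∃ uπ : Fin N → EnrichedVEM.Plane → ℝ,
        (∀ k, uπ k ∈ EnrichedVEM.enrichedSpace p Ω A θ α γ' T k) ∧
        (∀ k ∈ EnrichedVEM.layer1 Ω A γ' T, ∃ q ∈ EnrichedVEM.polySpace p,
          ∀ x ∈ EnrichedVEM.element Ω T k,
            uπ k x = κ * EnrichedVEM.singularAt A θ α 1 x + q x) ∧
        (∑ k, EnrichedVEM.sobolevSq 1 (EnrichedVEM.element Ω T k) (u - uπ k)) ^ (1 / 2 : ℝ) ≤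
          ENNReal.ofReal (c * EnrichedVEM.meshSize T ^ p) *
            ((∑ k ∈ EnrichedVEM.layer1 Ω A γ' T,
                EnrichedVEM.sobolevSq (p + 1) (EnrichedVEM.element Ω T k) u₀) ^ (1 / 2 : ℝ) +
             (∑ k ∈ EnrichedVEM.layer2 Ω A γ' T ∪ EnrichedVEM.layer3 Ω A γ' T,
                EnrichedVEM.sobolevSq (p + 1) (EnrichedVEM.element Ω T k) u) ^ (1 / 2 : ℝ)) := by
  classical
  have hK : (0 : ℝ) < 4 + 16 / γ ^ 2 := by positivity
  refine ⟨√(4 + 16 / γ ^ 2) ^ p, by positivity, ?_⟩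
  intro Ω hΩ A β ω θ hv j _ α _ hαp f u u₀ κ _ _ _ hu₀ hu N T γ' _ hT hreg hAT
  have hAΩ : A ∉ Ω := hv.notMem hΩ.isOpen
  have huE : ∀ k, u =ᵐ[volume.restrict (element Ω T k)]
      fun x => u₀ x + κ * singularAt A θ α 1 x := fun k =>
    ae_mono (Measure.restrict_mono Set.inter_subset_right le_rfl) hu
  have hE : ∀ k, MeasurableSet (element Ω T k) := fun k =>
    ((T k).isOpen.inter hΩ.isOpen).measurableSet
  have hu₀s : ∀ k, ContDiffOn ℝ (⊤ : ℕ∞) u₀ (T k).region := fun k x hx =>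
    (hu₀ x (hT.region_subset k hx)).contDiffAt.contDiffWithinAt
  have hex : ∀ k, ∃ w ∈ enrichedSpace p Ω A θ α γ' T k,
      (k ∈ layer1 Ω A γ' T → ∃ q ∈ polySpace p, ∀ x ∈ element Ω T k,
        w x = κ * singularAt A θ α 1 x + q x) ∧
      (k ∈ layer1 Ω A γ' T → sobolevSq 1 (element Ω T k) (u - w) ≤
        ENNReal.ofReal (meshSize T ^ 2 * (4 + 16 / γ ^ 2)) ^ p *
          sobolevSq (p + 1) (element Ω T k) u₀) ∧
      (k ∉ layer1 Ω A γ' T → sobolevSq 1 (element Ω T k) (u - w) ≤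
        ENNReal.ofReal (meshSize T ^ 2 * (4 + 16 / γ ^ 2)) ^ p *
          sobolevSq (p + 1) (element Ω T k) u) := by
    intro k
    by_cases hk : k ∈ layer1 Ω A γ' T
    · obtain ⟨q, hq, hle⟩ := exists_polySpace_sobolevSq_le hΩ hT hγ0 hreg p k (hu₀s k)
        (ae_eq_refl u₀)
      obtain ⟨a, g, hg, hs⟩ := singularAt_one_eq hv hAΩ hαp (T k).size_pos
      have hw : ∀ x ∈ element Ω T k,
          (q + κ • g + (κ * a) • singularAt A θ α (T k).size) x
            = κ * singularAt A θ α 1 x + q x := by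
        intro x hx
        simp only [Pi.add_apply, Pi.smul_apply, smul_eq_mul, hs x hx.2]
        ring
      -- The last two terms are `κ S` rewritten through the rescaled singular function.
      refine ⟨q + κ • g + (κ * a) • singularAt A θ α (T k).size, ?_,
        fun _ => ⟨q, hq, hw⟩, fun _ => ?_, fun h => absurd hk h⟩
      · rw [enrichedSpace, if_pos hk]
        exact Submodule.add_mem_sup (add_mem hq ((polySpace p).smul_mem κ hg))
          (Submodule.smul_mem _ _ (Submodule.mem_span_singleton_self _))
      · refine (sobolevSq_le_of_ae_eq ?_ 1).trans hle
        filter_upwards [huE k, ae_restrict_mem (hE k)] with x hx hxE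
        rw [Pi.sub_apply, Pi.sub_apply, hx, hw x hxE]
        ring
    · obtain ⟨z, ρ, hρ, hstar⟩ := hreg.starShaped k
      have hz := hstar z (Metric.mem_ball_self ((mul_pos hγ0 (T k).size_pos).trans_le hρ))
      -- Outside the first layer the polygon does not contain `A`, so a smooth extension across
      -- cracks exists.
      obtain ⟨F, hF, hFS⟩ := exists_contDiffOn_eqOn_singularAt (α := α) hv hz
        (fun h => hk (hAT k h)) Set.inter_subset_left Set.inter_subset_right (hT.connected k)
      have huF : u =ᵐ[volume.restrict (element Ω T k)] fun x => u₀ x + κ * F x := by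
        filter_upwards [huE k, ae_restrict_mem (hE k)] with x hx hxE
        rw [hx, hFS hxE]
      obtain ⟨q, hq, hle⟩ := exists_polySpace_sobolevSq_le hΩ hT hγ0 hreg p k
        ((hu₀s k).add (contDiffOn_const.mul hF)) huF
      exact ⟨q, by rwa [enrichedSpace, if_neg hk], fun h => absurd h hk, fun h => absurd h hk,
        fun _ => hle⟩
  choose w hw hsing hle₁ hle₂ using hex
  refine ⟨w, hw, hsing, ?_⟩
  have hmem : ∀ k, k ∈ layer2 Ω A γ' T ∪ layer3 Ω A γ' T ↔ k ∉ layer1 Ω A γ' T := by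
    intro k
    simp only [layer2, layer3, Finset.mem_union, Finset.mem_filter, Finset.mem_univ, true_and]
    tauto
  exact rpow_half_sum_le (Finset.disjoint_left.2 fun k h₁ h₂ => (hmem k).1 h₂ h₁)
    (Finset.eq_univ_iff_forall.2 fun k => Finset.mem_union.2
      ((em _).imp_right fun h => (hmem k).2 h))
    (Real.iSup_nonneg fun k => (T k).size_pos.le) hK.le (fun k hk => hle₁ k hk)
    fun k hk => hle₂ k ((hmem k).1 hk)
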